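/- **Conventions.** Let $M$ be a metric space. A constant speed geodesic from $x$ to $y$ is a map $\gamma\colon[0,1]\to M$ with $\gamma(0)=x$, $\gamma(1)=y$ and $d(\gamma(s),\gamma(t))=|s-t|\,d(x,y)$ for all $s,t$. A subset $A\subseteq M$ is *convex* if any two points of $A$ are joined by a unique constant speed geodesic of $M$ and this geodesic lies in $A$. The *convexity radius* of $M$ is $\varrho_M=\inf_{x\in M}\sup\{r>0 : B_s(x)\text{ is convex for all } s<r\}\in[0,\infty]$. For $\kappa\in\mathbb R$ let $M_\kappa$ be the sphere of radius $1/\sqrt\kappa$ in $\mathbb R^3$ with its geodesic distance ($\kappa>0$), the Euclidean plane ($\kappa=0$), or the hyperbolic plane rescaled by $1/\sqrt{-\kappa}$ ($\kappa<0$), and let $\varpi_\kappa=\pi/\sqrt\kappa$ if $\kappa>0$ and $\varpi_\kappa=\infty$ otherwise. A metric space is $\mathrm{CAT}(\kappa)$ if any two points at distance $<\varpi_\kappa$ are joined by a geodesic and, for each geodesic triangle of perimeter $<2\varpi_\kappa$, the canonical map from its comparison triangle in $M_\kappa$ is $1$-Lipschitz. A geodesic space has *curvature bounded above by $\kappa$*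 if every point has a neighbourhood that is a $\mathrm{CAT}(\kappa)$ space. For $\delta\in[0,\infty]$ let $\mathcal R^\delta(M)$ be the simplicial set whose $n$-simplices are the sequences $(x_0,\dots,x_n)$ in $M$ with $d(x_i,x_j)<\delta$ for all $i,j$. Let $\mathrm{sd}_b$ be the barycentric subdivision functor on simplicial sets and $\lambda_b\colon \mathrm{sd}_b\Rightarrow 1$ the last vertex map (on $\mathrm{sd}_b\Delta^n$, the nerve of the poset of nonempty subsets of $\{0,\dots,n\}$, it sends a subset to its maximum). The vertices of $\mathrm{sd}_b X$ correspond to the nondegenerate simplices of $X$. A *Chebyshev center* of $A\subseteq M$ is the center of a closed ball of minimal radius among all closed balls containing $A$. Let $C\ge 0$, $0<S<1$ and $0<\rho\le\infty$. A map $\Theta\colon \mathrm{sd}_b\mathcal R^\rho(M)_0\to M$ is a *pseudo-barycenter map* with respect to $(\mathrm{sd}_b,\lambda_b)$ with constants $C,S$ if for all $0<\delta\le\rho$: (a) $d(\lambda_b(x),\Theta(x))\le C\delta$ for every $x\in \mathrm{sd}_b\mathcal R^\delta(M)_0$; (b) whenever there is a $1$-simplex from $x$ to $y$ in $\mathrm{sd}_b\mathcal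 R^\delta(M)$, one has $d(\Theta(x),\Theta(y))<S\delta$ and $d(\lambda_b(x),\Theta(y))<S\delta$. **Proposition 5.4.** Let $M$ be a compact metric space of curvature bounded above by $\kappa\in\mathbb R$, and let $\rho=\min\{\varrho_M,\varpi_\kappa/4\}\in[0,\infty]$. Then $\rho>0$; for every simplex $(x_0,\dots,x_n)$ of $\mathcal R^\rho(M)$ the set $\{x_0,\dots,x_n\}$ has exactly one Chebyshev center in $M$; and there is exactly one map $\Theta\colon\mathrm{sd}_b\mathcal R^\rho(M)_0\to M$ that sends the vertex given by a nondegenerate simplex $(x_0,\dots,x_n)$ to the Chebyshev center of $\{x_0,\dots,x_n\}$. This map $\Theta$ is a pseudo-barycenter map with respect to the barycentric subdivision functor $\mathrm{sd}_b$ and the last vertex map $\lambda_b$, with constants $C=S=\tfrac34$. -/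

import Mathlib

open CategoryTheory Simplicial Opposite Topology
open scoped NNReal ENNReal

universe u

/-! ### Geodesics, convexity and curvature bounds -/

/-- `γ : [0,1] → Y` is a constant speed geodesic from `x` to `y` for the distance function `d`. -/
structure IsConstantSpeedGeodesic {Y : Type*} (d : Y → Y → ℝ) (γ : unitInterval → Y)
    (x y : Y) : Prop where
  source : γ 0 = x
  target : γ 1 = y
  dist_eq : ∀ s t : unitInterval, d (γ s) (γ t) = |(s : ℝ) - (t : ℝ)| * d x y

/-- `A ⊆ M` is (strongly) convex: any two points of `A` are joined by a unique constant speed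
geodesic of `M`, and this geodesic stays in `A`. -/
def IsGeodesicallyConvex {M : Type*} [MetricSpace M] (A : Set M) : Prop :=
  ∀ x ∈ A, ∀ y ∈ A,
    (∃! γ : unitInterval → M, IsConstantSpeedGeodesic dist γ x y) ∧
    ∀ γ : unitInterval → M, IsConstantSpeedGeodesic dist γ x y → ∀ t, γ t ∈ A

/-- The convexity radius of `M` at `x`: the supremum in `[0, ∞]` of the `r > 0` such that all
open balls about `x` of radius `s < r` are convex. -/
noncomputable def convexityRadiusAt {M : Type*} [MetricSpace M] (x : M) : ℝ≥0∞ :=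
  ⨆ (r : ℝ) (_ : 0 < r ∧ ∀ s < r, IsGeodesicallyConvex (Metric.ball x s)), ENNReal.ofReal r

/-- The convexity radius of `M`, an element of `[0, ∞]`. -/
noncomputable def convexityRadius (M : Type*) [MetricSpace M] : ℝ≥0∞ :=
  ⨅ x : M, convexityRadiusAt x

/-- The diameter of the model plane of curvature `κ`: it is `π / √κ` if `κ > 0`, and `∞`
otherwise. -/
noncomputable def modelDiam (κ : ℝ) : ℝ≥0∞ :=
  if 0 < κ then ENNReal.ofReal (Real.pi / √κ) else ⊤

/-- The model plane of constant curvature `κ`, as a set with a distance function: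
the sphere of radius `1 / √κ` in `ℝ³` with its geodesic distance (radius times angle) if `κ > 0`,
the Euclidean plane if `κ = 0`, and the hyperbolic plane rescaled by `1 / √(-κ)` if `κ < 0`. -/
noncomputable def modelPlane (κ : ℝ) : Σ Y : Type, Y → Y → ℝ :=
  if 0 < κ then
    ⟨Metric.sphere (0 : EuclideanSpace ℝ (Fin 3)) (1 / √κ),
      fun p q => 1 / √κ * InnerProductGeometry.angle p.1 q.1⟩
  else if κ = 0 then
    ⟨EuclideanSpace ℝ (Fin 2), fun p q => dist p q⟩
  else
    ⟨UpperHalfPlane, fun p q => 1 / √(-κ) * dist p q⟩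

/-- A geodesic triangle for the distance function `d`: three vertices `p 0`, `p 1`, `p 2`, and for
each `i` a side `γ i`, a constant speed geodesic from `p i` to `p (i + 1)` (indices mod 3). -/
def IsGeodesicTriangle {Y : Type*} (d : Y → Y → ℝ) (p : Fin 3 → Y)
    (γ : Fin 3 → unitInterval → Y) : Prop :=
  ∀ i, IsConstantSpeedGeodesic d (γ i) (p i) (p (i + 1))

/-- `X` is a CAT(`κ`) space: points at distance less than the diameter of the model plane are
joined by a geodesic, and for every geodesic triangle of perimeter less than twice that diameter
the map from its comparison triangle in the model plane is `1`-Lipschitz. (The comparison triangle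
exists and is unique up to isometry under the bound on the perimeter, so that asking this for
one comparison triangle is the same as asking it for all of them.) -/
structure IsCATSpace (κ : ℝ) (X : Type*) [MetricSpace X] : Prop where
  exists_geodesic : ∀ x y : X, edist x y < modelDiam κ →
    ∃ γ : unitInterval → X, IsConstantSpeedGeodesic dist γ x y
  comparison : ∀ (p : Fin 3 → X) (γ : Fin 3 → unitInterval → X), IsGeodesicTriangle dist p γ →
    edist (p 0) (p 1) + edist (p 1) (p 2) + edist (p 2) (p 0) < 2 * modelDiam κ →
    ∃ (q : Fin 3 → (modelPlane κ).1) (η : Fin 3 → unitInterval → (modelPlane κ).1),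
      IsGeodesicTriangle (modelPlane κ).2 q η ∧
      (∀ i, (modelPlane κ).2 (q i) (q (i + 1)) = dist (p i) (p (i + 1))) ∧
      ∀ i j s t, dist (γ i s) (γ j t) ≤ (modelPlane κ).2 (η i s) (η j t)

/-- `M` is a geodesic space of curvature bounded above by `κ`: every point has a neighbourhood
which, with the restricted metric, is a CAT(`κ`) space. -/
structure IsCurvatureBoundedAbove (κ : ℝ) (M : Type*) [MetricSpace M] : Prop where
  exists_geodesic : ∀ x y : M, ∃ γ : unitInterval → M, IsConstantSpeedGeodesic dist γ x y
  exists_nhds : ∀ x : M, ∃ U ∈ 𝓝 x, IsCATSpace κ U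

/-- The scale `min {convexity radius of M, (diameter of the model plane) / 4}` in `[0, ∞]`. -/
noncomputable def curvatureScale (κ : ℝ) (M : Type*) [MetricSpace M] : ℝ≥0∞ :=
  min (convexityRadius M) (modelDiam κ / 4)

/-- `c` is a Chebyshev center of `A`: the center of a closed ball of minimal radius among
all closed balls that contain `A`. -/
def IsChebyshevCenter {M : Type*} [MetricSpace M] (A : Set M) (c : M) : Prop :=
  ∃ r : ℝ, A ⊆ Metric.closedBall c r ∧
    ∀ (c' : M) (r' : ℝ), A ⊆ Metric.closedBall c' r' → r ≤ r'

/-! ### The (open) Vietoris-Rips simplicial set -/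

/-- The Vietoris-Rips simplicial set at scale `δ`: its `n`-simplices are the sequences
`(x 0, …, x n)` in `M` with pairwise distances smaller than `δ`. -/
def ripsSSet (M : Type u) [MetricSpace M] (δ : ℝ≥0∞) : SSet.{u} where
  obj n := {x : Fin (n.unop.len + 1) → M // ∀ i j, edist (x i) (x j) < δ}
  map f := TypeCat.ofHom fun x => ⟨x.1 ∘ f.unop.toOrderHom, fun _ _ => x.2 _ _⟩

/-- The inclusion of Vietoris-Rips simplicial sets for `δ ≤ ρ`. -/
def ripsInclusion (M : Type u) [MetricSpace M] {δ ρ : ℝ≥0∞} (h : δ ≤ ρ) :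
    ripsSSet M δ ⟶ ripsSSet M ρ where
  app n := TypeCat.ofHom fun x => ⟨x.1, fun i j => (x.2 i j).trans_le h⟩

/-- The point of `M` underlying a vertex of the Vietoris-Rips simplicial set. -/
def ripsPoint {M : Type u} [MetricSpace M] {δ : ℝ≥0∞} (x : (ripsSSet M δ) _⦋0⦌) : M :=
  x.1 0

/-! ### Barycentric subdivision and the last vertex map -/

/-- The maximum of a nonempty subset of `{0, …, n}`. -/
def chainMax {n : ℕ} (A : PartialOrder.NonemptyFiniteChains (ULift.{u} (Fin (n + 1)))) :
    Fin (n + 1) :=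
  A.finset.sup' A.nonempty ULift.down

theorem chainMax_mono {n : ℕ} : Monotone (chainMax.{u} (n := n)) :=
  fun _ _ h => Finset.sup'_mono _ h _

theorem chainMax_map {n n' : ℕ} (A : PartialOrder.NonemptyFiniteChains (ULift.{u} (Fin (n + 1))))
    (f : ULift.{u} (Fin (n + 1)) →o ULift.{u} (Fin (n' + 1))) :
    chainMax (A.map f) = (f (ULift.up (chainMax A))).down := by
  have hg : Monotone fun i : Fin (n + 1) => (f (ULift.up i)).down :=
    fun _ _ h => f.monotone h
  have h := Finset.apply_sup'_eq_sup'_comp (f := ULift.down) A.nonempty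
    (fun i : Fin (n + 1) => (f (ULift.up i)).down) (fun a b => hg.map_sup a b)
  refine Eq.trans ?_ h.symm
  simp only [chainMax, PartialOrder.NonemptyFiniteChains.map, Finset.sup'_image]
  rfl

/-- On the subdivision of the standard simplex (the nerve of the poset of nonempty subsets of
`{0, …, n}`), the last vertex map sends a nonempty subset to its maximum. -/
noncomputable def lastVertexSimplex : SimplexCategory.sd.{u} ⟶ SSet.stdSimplex.{u} where
  app n :=
    { app := fun m => TypeCat.ofHom fun (s : ComposableArrows _ _) => SSet.stdSimplex.objMk
        { toFun := fun i => chainMax (s.obj i)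
          monotone' := fun i j h => chainMax_mono (leOfHom (s.map (homOfLE h))) }
      naturality := fun _ _ _ => rfl }
  naturality := fun n n' f => by
    ext m s
    refine SSet.stdSimplex.objEquiv.injective ?_
    ext i : 3
    exact chainMax_map (n := n.len) (n' := n'.len) (s.obj i)
      (SimplexCategory.toPartOrd.{u}.map f).hom

/-- The last vertex map `λ : sd ⟶ 𝟭`, a natural transformation: the extension of the maps
`sd Δ[n] ⟶ Δ[n]` along colimits. -/
noncomputable def lastVertexMap : SSet.sd.{u} ⟶ 𝟭 SSet.{u} :=
  SSet.sd.descOfIsLeftKanExtension SSet.stdSimplex.sdIso.inv (𝟭 _)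
    (lastVertexSimplex ≫ (Functor.rightUnitor _).inv)

/-- The vertex of `SimplexCategory.sd.obj ⦋n⦌` given by the full subset `{0, …, n}`. -/
def topChain (n : ℕ) : PartialOrder.NonemptyFiniteChains (ULift.{u} (Fin (n + 1))) where
  finset := Finset.univ
  nonempty := Finset.univ_nonempty
  comparable a b := le_total a.1.down b.1.down

/-- The vertex of `sd X` corresponding to the simplex `x` of `X`: the barycenter of `x`. -/
noncomputable def sdVertex (X : SSet.{u}) {n : ℕ} (x : X _⦋n⦌) : (SSet.sd.obj X) _⦋0⦌ :=
  (SSet.sd.map (SSet.yonedaEquiv.symm x)).app _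
    ((SSet.stdSimplex.sdIso.inv.app ⦋n⦌).app _ (ComposableArrows.mk₀ (topChain n)))

/-! ### Pseudo-barycenter maps -/

/-- `Θ : sd (R^ρ(M))₀ → M` is a pseudo-barycenter map with constants `C ≥ 0`, `0 < S < 1` and
`ρ > 0`, with respect to the functor `sd` and the natural transformation `lam : sd ⟶ 𝟭`. Vertices
of `sd (R^δ(M))` are regarded as vertices of `sd (R^ρ(M))` through the inclusion; a `1`-simplex
`e` goes from its vertex `d₁ e` to its vertex `d₀ e`. -/
structure IsPseudoBarycenterMap (M : Type u) [MetricSpace M] (sd : SSet.{u} ⥤ SSet.{u})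
    (lam : sd ⟶ 𝟭 SSet.{u}) (C S : ℝ≥0) (ρ : ℝ≥0∞)
    (Θ : (sd.obj (ripsSSet M ρ)) _⦋0⦌ → M) : Prop where
  S_pos : 0 < S
  S_lt_one : S < 1
  scale_pos : 0 < ρ
  close : ∀ (δ : ℝ≥0∞) (h : δ ≤ ρ), 0 < δ → ∀ x : (sd.obj (ripsSSet M δ)) _⦋0⦌,
    edist (ripsPoint ((lam.app (ripsSSet M δ)).app _ x))
      (Θ ((sd.map (ripsInclusion M h)).app _ x)) ≤ C * δ
  shrink : ∀ (δ : ℝ≥0∞) (h : δ ≤ ρ), 0 < δ → ∀ x y : (sd.obj (ripsSSet M δ)) _⦋0⦌,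
    (∃ e : (sd.obj (ripsSSet M δ)) _⦋1⦌,
      (sd.obj (ripsSSet M δ)).δ 1 e = x ∧ (sd.obj (ripsSSet M δ)).δ 0 e = y) →
    edist (Θ ((sd.map (ripsInclusion M h)).app _ x))
        (Θ ((sd.map (ripsInclusion M h)).app _ y)) < S * δ ∧
      edist (ripsPoint ((lam.app (ripsSSet M δ)).app _ x))
        (Θ ((sd.map (ripsInclusion M h)).app _ y)) < S * δ

/-- `Θ` sends the vertex of the barycentric subdivision of `R^ρ(M)` that corresponds to a
nondegenerate simplex `(x 0, …, x n)` to a Chebyshev center of `{x 0, …, x n}`. -/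
def IsChebyshevCenterMap (M : Type u) [MetricSpace M] (ρ : ℝ≥0∞)
    (Θ : (SSet.sd.obj (ripsSSet M ρ)) _⦋0⦌ → M) : Prop :=
  ∀ (n : ℕ) (x : (ripsSSet M ρ) _⦋n⦌), x ∈ (ripsSSet M ρ).nonDegenerate n →
    IsChebyshevCenter (Set.range x.1) (Θ (sdVertex (ripsSSet M ρ) x))

/-! ### Vertices of the barycentric subdivision -/

section Subdivision

open PartialOrder

/-! Everything metric is reduced to comparison with a sphere of curvature `k ^ 2`, where `k = √κ` if
`κ > 0`. If `κ ≤ 0`, any `k > 0` is allowed, and compactness permits one so small that `k` times the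
diameter is below `π / 4`. The CAT condition and a Lebesgue number give, for all sufficiently small
triangles, a midpoint inequality for `cos (k * dist z ·)` (`HasLocalMidpointInequality`). This is a
discrete form of `f'' + f ≤ 0` along geodesics, so `sin_interpolation_le` turns it into comparison
with a sinusoid on a whole side. Small balls are therefore convex and the scale is positive.

The scale itself may be much larger than the size at which curvature is controlled, so the
inequality must be globalized inside convex balls. Points of such a ball have a unique geodesic to
its center `z`, and compactness makes these geodesics vary continuously. A thin triangle with far
apex `z` is then a chain of small quadrilaterals. In the Euclidean cone over `(M, k • dist)`
spherical comparison becomes nonpositive curvature, and `coneDistSq_chain_le` sums the quadrilateral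
inequalities with Cauchy-Schwarz. Concavity along the opposite side is a local condition, so thin
triangles suffice (`sin_interpolation_le_of_convex`).

Let `c` be a Chebyshev center of `A` with radius `r`. When `c` is moved towards `q`, some point of
`A` does not come closer than `r`. Comparison and a limit at `c` give `b ≤ cos (k * r) * cos (k *
dist c q)` for any lower bound `b` of `cos (k * dist y q)` on `A` (`IsCircumcenter.le_cos_mul_cos`).
Taking `q` in `A` at distance `r` yields Jung's bound `r ≤ 3 / 4 * D` for diameter at most `D`.
Taking `q` to be a center of a larger set `B` bounds the distance of the two centers by the radius
of `B`, and `A = B` gives uniqueness.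

On the simplicial side, a vertex of `sd X` has a well-defined set of vertices of `X`, which grows
along edges, and every vertex is the barycenter of a nondegenerate simplex. So `Θ` must send a
vertex to the center of its set, and the metric estimates are exactly the two conditions on `Θ`. -/

/-- The poset of sets of vertices of a simplicial set. -/
def vertexSetFunctor : SSet.{u} ⥤ PartOrd.{u} where
  obj X := .of (Set (X _⦋0⦌))
  map f := PartOrd.ofHom ⟨fun A => f.app _ '' A, fun _ _ h => Set.image_mono h⟩
  map_id X := by
    ext A
    simp
  map_comp f g := by
    ext A
    simp

/-- The action of a morphism of the simplex category on chains. -/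
noncomputable def chainMap {n m : ℕ} (f : ⦋n⦌ ⟶ ⦋m⦌)
    (c : NonemptyFiniteChains (ULift.{u} (Fin (n + 1)))) :
    NonemptyFiniteChains (ULift.{u} (Fin (m + 1))) :=
  c.map ⟨fun i => ULift.up (f.toOrderHom i.down), fun _ _ h => f.toOrderHom.monotone h⟩

theorem mem_chainMap {n m : ℕ} (f : ⦋n⦌ ⟶ ⦋m⦌)
    (c : NonemptyFiniteChains (ULift.{u} (Fin (n + 1)))) (j : Fin (m + 1)) :
    ULift.up j ∈ (chainMap f c).finset ↔ ∃ i, ULift.up i ∈ c.finset ∧ f.toOrderHom i = j := by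
  unfold chainMap
  rw [NonemptyFiniteChains.mem_map_iff]
  constructor
  · rintro ⟨x, hx, h⟩
    exact ⟨x.down, hx, congrArg ULift.down h⟩
  · rintro ⟨i, hi, h⟩
    exact ⟨⟨i⟩, hi, congrArg ULift.up h⟩

/-- A chain in `{0, …, n}`, as a set of vertices of the standard simplex. -/
def chainVertexSet (n : SimplexCategory)
    (A : NonemptyFiniteChains (ULift.{u} (Fin (n.len + 1)))) :
    Set ((SSet.stdSimplex.{u}.obj n) _⦋0⦌) :=
  {v | ULift.up (SSet.stdSimplex.obj₀Equiv (n := n.len) v) ∈ A.finset}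

theorem chainVertexSet_chainMap {n m : ℕ} (f : ⦋n⦌ ⟶ ⦋m⦌)
    (A : NonemptyFiniteChains (ULift.{u} (Fin (n + 1)))) :
    chainVertexSet ⦋m⦌ (chainMap f A) =
      (SSet.stdSimplex.{u}.map f).app (op ⦋0⦌) '' chainVertexSet ⦋n⦌ A := by
  ext v
  refine (mem_chainMap f A _).trans ?_
  constructor
  · rintro ⟨i, hi, h⟩
    exact ⟨SSet.stdSimplex.obj₀Equiv.symm i, hi, SSet.stdSimplex.obj₀Equiv.injective h⟩
  · rintro ⟨w, hw, rfl⟩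
    exact ⟨_, hw, rfl⟩

/-- Naturality of the vertex set of a chain. -/
noncomputable def chainVertexSetNat :
    SimplexCategory.toPartOrd.{u} ⋙ PartOrd.nonemptyFiniteChainsFunctor ⟶
      SSet.stdSimplex.{u} ⋙ vertexSetFunctor.{u} where
  app n := PartOrd.ofHom ⟨chainVertexSet n, fun A B h v hv => h hv⟩
  naturality n n' f := by
    ext A
    exact chainVertexSet_chainMap (n := n.len) (m := n'.len) f A

/-- The set of vertices spanned by the simplices of the barycentric subdivision. -/
noncomputable def vertexSetMap : SSet.sd.{u} ⟶ vertexSetFunctor.{u} ⋙ PartOrd.nerveFunctor.{u} :=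
  SSet.sd.descOfIsLeftKanExtension SSet.stdSimplex.sdIso.inv _
    (Functor.whiskerRight chainVertexSetNat.{u} PartOrd.nerveFunctor.{u})

/-- The vertex set of a vertex of the subdivision. -/
noncomputable def sdVertexSet (X : SSet.{u}) (v : (SSet.sd.obj X) _⦋0⦌) : Set (X _⦋0⦌) :=
  ComposableArrows.obj' ((vertexSetMap.app X).app _ v : ComposableArrows _ 0) 0

/-- The vertex of `sd X` given by a simplex of `X` and a face of that simplex. -/
noncomputable def sdVertexOfChain (X : SSet.{u}) {n : ℕ} (x : X _⦋n⦌)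
    (c : NonemptyFiniteChains (ULift.{u} (Fin (n + 1)))) : (SSet.sd.obj X) _⦋0⦌ :=
  (SSet.sd.map (SSet.yonedaEquiv.symm x)).app _
    ((SSet.stdSimplex.sdIso.inv.app ⦋n⦌).app _ (ComposableArrows.mk₀ c))

/-- Naturality lets a simplicial operator pass from the simplex to the chain. Applied to a face and
then to a degeneracy, it normalizes any vertex to a nondegenerate barycenter. -/
theorem sdVertexOfChain_map {X : SSet.{u}} {n m : ℕ} (f : ⦋n⦌ ⟶ ⦋m⦌) (x : X _⦋m⦌)
    (c : NonemptyFiniteChains (ULift.{u} (Fin (n + 1)))) :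
    sdVertexOfChain X (X.map f.op x) c =
      sdVertexOfChain X x (chainMap f c) := by
  unfold sdVertexOfChain
  have h1 : SSet.yonedaEquiv.symm (X.map f.op x) =
      SSet.stdSimplex.map f ≫ SSet.yonedaEquiv.symm x :=
    (SSet.yonedaEquiv_symm_naturality_left f x).symm
  rw [h1, Functor.map_comp]
  have h2 := SSet.stdSimplex.sdIso.{u}.inv.naturality f
  have h3 := congrArg (fun g => g.app (op ⦋0⦌)) h2
  have h4 := ConcreteCategory.congr_hom h3 (ComposableArrows.mk₀ c)
  refine (congrArg ((SSet.sd.map (SSet.yonedaEquiv.symm x)).app (op ⦋0⦌))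
    (h4.symm.trans ?_) :)
  refine congrArg ((SSet.stdSimplex.sdIso.inv.app ⦋m⦌).app (op ⦋0⦌)) ?_
  exact ComposableArrows.ext₀ rfl

/-! ### Every vertex of the subdivision is a barycenter. -/

/-- Morphisms out of `sd X` are determined by their restrictions to the subdivided simplices. -/
theorem sd_hom_ext {X Z : SSet.{u}} (f g : SSet.sd.obj X ⟶ Z)
    (h : ∀ (n : ℕ) (x : X _⦋n⦌), SSet.sd.map (SSet.yonedaEquiv.symm x) ≫ f =
      SSet.sd.map (SSet.yonedaEquiv.symm x) ≫ g) : f = g := by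
  -- Across the adjunction of `sd` and `Ex` the claim concerns maps out of `X`, which are determined
  -- on simplices by Yoneda.
  apply (SSet.sdExAdjunction.homEquiv X Z).injective
  ext ⟨m⟩ x
  induction m using SimplexCategory.rec with | _ n
  have h1 := congrArg (SSet.sdExAdjunction.homEquiv _ Z) (h n x)
  rw [Adjunction.homEquiv_naturality_left, Adjunction.homEquiv_naturality_left] at h1
  have h2 := congrArg SSet.yonedaEquiv h1
  rw [SSet.yonedaEquiv_comp, SSet.yonedaEquiv_comp, Equiv.apply_symm_apply] at h2
  exact h2

/-- The images of the subdivided simplices form a subcomplex whose inclusion is an epimorphism,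
because maps out of `sd X` are determined on them. Epimorphisms of simplicial sets are surjective in
each degree. -/
theorem exists_sdVertexOfChain (X : SSet.{u}) (v : (SSet.sd.obj X) _⦋0⦌) :
    ∃ (n : ℕ) (x : X _⦋n⦌) (c : NonemptyFiniteChains (ULift.{u} (Fin (n + 1)))),
      v = sdVertexOfChain X x c := by
  let A : (SSet.sd.obj X).Subcomplex :=
    ⨆ s : (Σ n : ℕ, X _⦋n⦌), SSet.Subcomplex.range (SSet.sd.map (SSet.yonedaEquiv.symm s.2))
  have hepi : Epi A.ι := by
    refine ⟨fun {Z} f g hfg => sd_hom_ext f g fun n x => ?_⟩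
    have hle : SSet.Subcomplex.range (SSet.sd.map (SSet.yonedaEquiv.symm x)) ≤ A :=
      le_iSup (fun s : (Σ n : ℕ, X _⦋n⦌) =>
        SSet.Subcomplex.range (SSet.sd.map (SSet.yonedaEquiv.symm s.2))) ⟨n, x⟩
    have hfac : SSet.sd.map (SSet.yonedaEquiv.symm x) = SSet.Subcomplex.lift _ hle ≫ A.ι := by
      simp
    rw [hfac, Category.assoc, Category.assoc, hfg]
  have hsurj : Function.Surjective (A.ι.app (op ⦋0⦌)) :=
    (epi_iff_surjective _).1 ((NatTrans.epi_iff_epi_app A.ι).1 hepi _)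
  obtain ⟨⟨w, hw⟩, rfl⟩ := hsurj v
  simp only [A, Subfunctor.iSup_obj, Set.mem_iUnion] at hw
  obtain ⟨⟨n, x⟩, y, rfl⟩ := hw
  refine ⟨n, x, ComposableArrows.obj' ((SSet.stdSimplex.sdIso.hom.app ⦋n⦌).app _ y :
    ComposableArrows (NonemptyFiniteChains (ULift.{u} (Fin (n + 1)))) 0) 0, ?_⟩
  change (SSet.sd.map (SSet.yonedaEquiv.symm x)).app _ y = _
  refine congrArg _ ?_
  have h1 := SSet.stdSimplex.sdIso.{u}.hom_inv_id_app ⦋n⦌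
  have h2 := congrArg (fun g => g.app (op ⦋0⦌)) h1
  have h3 := ConcreteCategory.congr_hom h2 y
  refine h3.symm.trans ?_
  refine congrArg ((SSet.stdSimplex.sdIso.inv.app ⦋n⦌).app (op ⦋0⦌)) ?_
  exact ComposableArrows.ext₀ rfl

theorem exists_map_topChain {n : ℕ} (c : NonemptyFiniteChains (ULift.{u} (Fin (n + 1)))) :
    ∃ (m : ℕ) (f : ⦋m⦌ ⟶ ⦋n⦌),
      chainMap f (topChain.{u} m) = c := by
  classical
  let s : Finset (Fin (n + 1)) := c.finset.image ULift.down
  have hs : s.Nonempty := c.nonempty.image _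
  obtain ⟨m, hm⟩ : ∃ m, s.card = m + 1 :=
    ⟨s.card - 1, by have := hs.card_pos; omega⟩
  -- The increasing enumeration of the subset realizes it as the image of a full chain. The
  -- dimension is one less than the cardinality.
  refine ⟨m, SimplexCategory.mkHom (s.orderEmbOfFin hm).toOrderHom, ?_⟩
  ext ⟨i⟩
  refine (mem_chainMap _ _ i).trans ?_
  have hi : (ULift.up i ∈ c.finset) ↔ i ∈ Set.range (s.orderEmbOfFin hm) := by
    simp [s]
  rw [hi]
  constructor
  · rintro ⟨j, -, h⟩
    exact ⟨j, h⟩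
  · rintro ⟨j, rfl⟩
    exact ⟨j, Finset.mem_univ _, rfl⟩

theorem map_topChain_of_epi {n m : ℕ} (f : ⦋n⦌ ⟶ ⦋m⦌) [Epi f] :
    chainMap f (topChain.{u} n) = topChain.{u} m := by
  ext ⟨i⟩
  refine (mem_chainMap _ _ i).trans ?_
  obtain ⟨j, hj⟩ := SimplexCategory.epi_iff_surjective.1 (inferInstance : Epi f) i
  exact ⟨fun _ => Finset.mem_univ _, fun _ => ⟨j, Finset.mem_univ _, hj⟩⟩

/-- Every vertex of `sd X` is the barycenter of a nondegenerate simplex of `X`. -/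
theorem exists_sdVertex_nonDegenerate (X : SSet.{u}) (v : (SSet.sd.obj X) _⦋0⦌) :
    ∃ (n : ℕ) (x : X _⦋n⦌), x ∈ X.nonDegenerate n ∧ v = sdVertex X x := by
  obtain ⟨n, x, c, rfl⟩ := exists_sdVertexOfChain X v
  -- The face spanned by the chain replaces the simplex; then the degeneracy is stripped off, which
  -- preserves full chains.
  obtain ⟨m, f, rfl⟩ := exists_map_topChain c
  obtain ⟨l, g, _, y, hy⟩ := X.exists_nonDegenerate (X.map f.op x)
  refine ⟨l, y.1, y.2, ?_⟩
  rw [← sdVertexOfChain_map, hy, sdVertexOfChain_map, map_topChain_of_epi]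
  rfl

/-! ### Vertex sets and last vertices of barycenters. -/

theorem sdVertexSet_map {X Y : SSet.{u}} (g : X ⟶ Y) (v : (SSet.sd.obj X) _⦋0⦌) :
    sdVertexSet Y ((SSet.sd.map g).app _ v) = g.app _ '' sdVertexSet X v := by
  have h := congrArg (fun g => g.app (op ⦋0⦌)) (vertexSetMap.{u}.naturality g)
  have h2 := ConcreteCategory.congr_hom h v
  exact congrArg (fun w : ComposableArrows (Set (Y _⦋0⦌)) 0 => w.obj' 0) h2

theorem yonedaEquiv_symm_app_vertex {X : SSet.{u}} {n : ℕ} (x : X _⦋n⦌) (i : Fin (n + 1)) :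
    (SSet.yonedaEquiv.symm x).app (op ⦋0⦌) (SSet.stdSimplex.obj₀Equiv.symm i) =
      X.map (SimplexCategory.const ⦋0⦌ ⦋n⦌ i).op x := by
  exact SSet.yonedaEquiv_symm_app_objEquiv_symm x (SimplexCategory.const ⦋0⦌ ⦋n⦌ i)

theorem sdVertexSet_sdVertex (X : SSet.{u}) {n : ℕ} (x : X _⦋n⦌) :
    sdVertexSet X (sdVertex X x) =
      Set.range fun i : Fin (n + 1) => X.map (SimplexCategory.const ⦋0⦌ ⦋n⦌ i).op x := by
  unfold sdVertex
  rw [sdVertexSet_map]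
  have h := SSet.sd.{u}.descOfIsLeftKanExtension_fac_app SSet.stdSimplex.sdIso.{u}.inv
    (vertexSetFunctor.{u} ⋙ PartOrd.nerveFunctor.{u})
    (Functor.whiskerRight chainVertexSetNat.{u} PartOrd.nerveFunctor.{u}) ⦋n⦌
  have h2 := congrArg (fun g => g.app (op ⦋0⦌)) h
  have h3 := ConcreteCategory.congr_hom h2 (ComposableArrows.mk₀ (topChain.{u} n))
  have h4 : sdVertexSet (SSet.stdSimplex.{u}.obj ⦋n⦌) ((SSet.stdSimplex.sdIso.inv.app ⦋n⦌).app _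
      (ComposableArrows.mk₀ (topChain.{u} n))) = chainVertexSet ⦋n⦌ (topChain.{u} n) :=
    congrArg (fun w : ComposableArrows (Set ((SSet.stdSimplex.{u}.obj ⦋n⦌) _⦋0⦌)) 0 => w.obj' 0) h3
  refine (congrArg (fun A => _ '' A) h4).trans ?_
  ext v
  constructor
  · rintro ⟨w, -, rfl⟩
    refine ⟨SSet.stdSimplex.obj₀Equiv w, ?_⟩
    obtain ⟨i, rfl⟩ := SSet.stdSimplex.obj₀Equiv.symm.surjective w
    exact (yonedaEquiv_symm_app_vertex x _).symm
  · rintro ⟨i, rfl⟩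
    exact ⟨SSet.stdSimplex.obj₀Equiv.symm i, Finset.mem_univ (ULift.up i), yonedaEquiv_symm_app_vertex x i⟩

/-- An edge of `sd X` is mapped to an edge in the nerve of the poset of vertex sets, that is, to an
inclusion from its source `δ 1` to its target `δ 0`. -/
theorem sdVertexSet_mono (X : SSet.{u}) (e : (SSet.sd.obj X) _⦋1⦌) :
    sdVertexSet X ((SSet.sd.obj X).δ 1 e) ⊆ sdVertexSet X ((SSet.sd.obj X).δ 0 e) := by
  let w : ComposableArrows (Set (X _⦋0⦌)) 1 := (vertexSetMap.app X).app _ e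
  have h1 : sdVertexSet X ((SSet.sd.obj X).δ 1 e) = w.obj' 0 := by
    have h := ConcreteCategory.congr_hom ((vertexSetMap.app X).naturality
      (SimplexCategory.δ (n := 0) 1).op) e
    exact congrArg (fun w : ComposableArrows (Set (X _⦋0⦌)) 0 => w.obj' 0) h
  have h0 : sdVertexSet X ((SSet.sd.obj X).δ 0 e) = w.obj' 1 := by
    have h := ConcreteCategory.congr_hom ((vertexSetMap.app X).naturality
      (SimplexCategory.δ (n := 0) 0).op) e
    exact congrArg (fun w : ComposableArrows (Set (X _⦋0⦌)) 0 => w.obj' 0) h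
  rw [h1, h0]
  exact leOfHom (w.map' 0 1)

theorem lastVertexMap_sdVertex (X : SSet.{u}) {n : ℕ} (x : X _⦋n⦌) :
    (lastVertexMap.app X).app _ (sdVertex X x) =
      X.map (SimplexCategory.const ⦋0⦌ ⦋n⦌ (Fin.last n)).op x := by
  unfold sdVertex
  have h0 := congrArg (fun g => g.app (op ⦋0⦌))
    (lastVertexMap.{u}.naturality (SSet.yonedaEquiv.symm x))
  refine (ConcreteCategory.congr_hom h0 _).trans ?_
  have h := SSet.sd.{u}.descOfIsLeftKanExtension_fac_app SSet.stdSimplex.sdIso.{u}.inv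
    (𝟭 SSet.{u}) (lastVertexSimplex.{u} ≫ (Functor.rightUnitor _).inv) ⦋n⦌
  have h2 := congrArg (fun g => g.app (op ⦋0⦌)) h
  have h3 := ConcreteCategory.congr_hom h2 (ComposableArrows.mk₀ (topChain.{u} n))
  refine (congrArg ((SSet.yonedaEquiv.symm x).app (op ⦋0⦌)) h3).trans ?_
  refine Eq.trans ?_ (yonedaEquiv_symm_app_vertex x (Fin.last n))
  refine congrArg ((SSet.yonedaEquiv.symm x).app (op ⦋0⦌)) ?_
  refine SSet.stdSimplex.obj₀Equiv.injective ?_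
  refine le_antisymm (Fin.le_last _) ?_
  exact Finset.le_sup' (s := (topChain.{u} n).finset) ULift.down
    (Finset.mem_univ (ULift.up (Fin.last n)))

end Subdivision

/-! ### Sinusoidal concavity in one variable -/

/-- A minimum principle for `f'' + f ≤ 0`, stated with symmetric differences because `f` is only
continuous. The step `ε` may depend on the point, so no uniformity is needed. -/
theorem sin_interpolation_le {f : ℝ → ℝ} {a b : ℝ} (hab : b - a < Real.pi)
    (hf : ContinuousOn f (Set.Icc a b))
    (hloc : ∀ s ∈ Set.Ioo a b, ∃ ε > 0, ∀ h, 0 < h → h < ε → s - h ∈ Set.Icc a b →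
      s + h ∈ Set.Icc a b → f (s - h) + f (s + h) ≤ 2 * Real.cos h * f s) :
    ∀ s ∈ Set.Icc a b,
      Real.sin (b - s) * f a + Real.sin (s - a) * f b ≤ Real.sin (b - a) * f s := by
  intro s1 hs1
  have hab0 : a ≤ b := hs1.1.trans hs1.2
  set g : ℝ → ℝ := fun s =>
    Real.sin (b - a) * f s - (Real.sin (b - s) * f a + Real.sin (s - a) * f b) with hg
  -- A comparison solution of `w'' + w = 0` that is positive on the whole interval, as its length is
  -- below `π`.
  set w : ℝ → ℝ := fun s => Real.cos (s - (a + b) / 2) with hw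
  have hsin : 0 ≤ Real.sin (b - a) :=
    Real.sin_nonneg_of_nonneg_of_le_pi (by linarith) hab.le
  have hgc : ContinuousOn g (Set.Icc a b) := by fun_prop
  have hwc : Continuous w := by fun_prop
  have hwpos : ∀ s ∈ Set.Icc a b, 0 < w s := fun s hs =>
    Real.cos_pos_of_mem_Ioo ⟨by linarith [hs.1], by linarith [hs.2]⟩
  have hga : g a = 0 := by simp [hg]
  have hgb : g b = 0 := by simp [hg]
  have hgloc : ∀ s ∈ Set.Ioo a b, ∃ ε > 0, ∀ h, 0 < h → h < ε → s - h ∈ Set.Icc a b →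
      s + h ∈ Set.Icc a b → g (s - h) + g (s + h) ≤ 2 * Real.cos h * g s := by
    intro s hs
    obtain ⟨ε, hε, H⟩ := hloc s hs
    refine ⟨ε, hε, fun h h0 h1 h2 h3 => ?_⟩
    have := mul_le_mul_of_nonneg_left (H h h0 h1 h2 h3) hsin
    simp only [hg]
    have e1 : Real.sin (b - (s - h)) + Real.sin (b - (s + h)) =
        2 * Real.cos h * Real.sin (b - s) := by
      rw [show b - (s - h) = (b - s) + h by ring, show b - (s + h) = (b - s) - h by ring,
        Real.sin_add, Real.sin_sub (b - s) h]
      ring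
    have e2 : Real.sin (s - h - a) + Real.sin (s + h - a) =
        2 * Real.cos h * Real.sin (s - a) := by
      rw [show s - h - a = (s - a) - h by ring, show s + h - a = (s - a) + h by ring,
        Real.sin_add, Real.sin_sub (s - a) h]
      ring
    linear_combination this - f a * e1 - f b * e2
  by_contra hneg
  have hneg : g s1 < 0 := by simp only [hg]; linarith
  obtain ⟨s2, hs2, hmin⟩ := isCompact_Icc.exists_isMinOn ⟨s1, hs1⟩
    (hgc.div hwc.continuousOn fun s hs => (hwpos s hs).ne')
  set μ : ℝ := g s2 / w s2 with hμ
  have hmin' : ∀ s ∈ Set.Icc a b, μ * w s ≤ g s := fun s hs =>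
    (le_div_iff₀ (hwpos s hs)).1 (hmin hs)
  have hμneg : μ < 0 := by
    have h1 := hmin' s1 hs1
    by_contra h
    nlinarith [hwpos s1 hs1]
  set G : ℝ → ℝ := fun s => g s - μ * w s with hG
  have hGc : ContinuousOn G (Set.Icc a b) := by fun_prop
  have hZ : IsCompact (Set.Icc a b ∩ G ⁻¹' {0}) :=
    isCompact_Icc.of_isClosed_subset
      (hGc.preimage_isClosed_of_isClosed isClosed_Icc isClosed_singleton) Set.inter_subset_left
  -- At the leftmost zero of the nonnegative function `G` the difference inequality forces a zero
  -- further left, a contradiction.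
  obtain ⟨s0, ⟨hs0, hG0⟩, hleast⟩ := hZ.exists_isLeast
    ⟨s2, hs2, by simp [hG, hμ, (hwpos s2 hs2).ne']⟩
  have hG0 : G s0 = 0 := hG0
  have hGn : ∀ s ∈ Set.Icc a b, 0 ≤ G s := fun s hs => sub_nonneg.2 (hmin' s hs)
  have h0a : s0 ≠ a := by
    rintro rfl
    have : G s0 = -μ * w s0 := by simp [hG, hga]
    nlinarith [hwpos s0 hs0]
  have h0b : s0 ≠ b := by
    rintro rfl
    have : G s0 = -μ * w s0 := by simp [hG, hgb]
    nlinarith [hwpos s0 hs0]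
  have ha : a < s0 := lt_of_le_of_ne hs0.1 h0a.symm
  have hb : s0 < b := lt_of_le_of_ne hs0.2 h0b
  obtain ⟨ε, hε, H⟩ := hgloc s0 ⟨ha, hb⟩
  obtain ⟨h, hh0, hh⟩ : ∃ h, 0 < h ∧ h < min ε (min (s0 - a) (b - s0)) :=
    exists_between (lt_min hε (lt_min (by linarith) (by linarith)))
  rw [lt_min_iff, lt_min_iff] at hh
  have hm : s0 - h ∈ Set.Icc a b := ⟨by linarith, by linarith⟩
  have hp : s0 + h ∈ Set.Icc a b := ⟨by linarith, by linarith⟩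
  have hineq := H h hh0 hh.1 hm hp
  have e : w (s0 - h) + w (s0 + h) = 2 * Real.cos h * w s0 := by
    simp only [hw]
    rw [show s0 - h - (a + b) / 2 = (s0 - (a + b) / 2) - h by ring,
      show s0 + h - (a + b) / 2 = (s0 - (a + b) / 2) + h by ring, Real.cos_add,
      Real.cos_sub (s0 - (a + b) / 2) h]
    ring
  have hsum : G (s0 - h) + G (s0 + h) ≤ 2 * Real.cos h * G s0 := by
    simp only [hG]
    linear_combination hineq - μ * e
  rw [hG0, mul_zero] at hsum
  have hz : G (s0 - h) = 0 := le_antisymm (by linarith [hGn _ hp]) (hGn _ hm)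
  have := hleast ⟨hm, hz⟩
  linarith

/-! ### Midpoint comparison in the model planes -/

/-- The derivative of `cos (k * x)` with respect to `F x` is `-k * sin (k * x) / F' x`, and `hanti`
says that it increases: the cosine is a convex function of `F`. Spreading two values of `F` with
fixed sum increases the sum of the cosines. Cauchy's mean value theorem replaces the change of
variables. -/
theorem cos_add_cos_le_of_add_eq {F F' : ℝ → ℝ} {k a b A B : ℝ} (hk : 0 < k)
    (hF : ∀ x, HasDerivAt F (F' x) x) (hpos : ∀ x, 0 < x → 0 < F' x)
    (hmono : StrictMonoOn F (Set.Ici 0)) (hb : k * b ≤ Real.pi)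
    (hanti : ∀ x y, 0 < x → x ≤ y → y ≤ b →
      F' x * Real.sin (k * y) ≤ Real.sin (k * x) * F' y)
    (ha : 0 ≤ a) (haB : a ≤ B) (hBA : B ≤ A) (hAb : A ≤ b) (hsum : F A + F B = F a + F b) :
    Real.cos (k * A) + Real.cos (k * B) ≤ Real.cos (k * a) + Real.cos (k * b) := by
  have hslope : ∀ u v, u < v → ∃ c ∈ Set.Ioo u v,
      (Real.cos (k * v) - Real.cos (k * u)) * F' c =
        (F v - F u) * (-Real.sin (k * c) * k) := by
    intro u v huv
    have hd : ∀ x, HasDerivAt (fun x => Real.cos (k * x)) (-Real.sin (k * x) * k) x := fun x => by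
      simpa using ((hasDerivAt_id x).const_mul k).cos
    exact exists_ratio_hasDerivAt_eq_ratio_slope F F' huv
      (fun x _ => (hF x).continuousAt.continuousWithinAt) (fun x _ => hF x)
      (fun x => Real.cos (k * x)) _ (fun x _ => (hd x).continuousAt.continuousWithinAt)
      (fun x _ => hd x)
  rcases haB.eq_or_lt with rfl | haB
  · have : A = b := hmono.injOn (ha.trans hBA) ((ha.trans hBA).trans hAb) (by linarith)
    rw [this, add_comm]
  rcases hAb.eq_or_lt with rfl | hAb
  · have : B = a := hmono.injOn (ha.trans haB.le) ha (by linarith)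
    rw [this, add_comm]
  obtain ⟨c, hc, h1⟩ := hslope a B haB
  obtain ⟨d, hd, h2⟩ := hslope A b hAb
  have hc0 : 0 < c := ha.trans_lt hc.1
  have hcd : c ≤ d := hc.2.le.trans (hBA.trans hd.1.le)
  have hfc := hpos c hc0
  have hfd := hpos d (hc0.trans_le hcd)
  have hΔ : 0 ≤ F B - F a := sub_nonneg.2 (hmono ha (ha.trans haB.le) haB).le
  have h3 := hanti c d hc0 hcd hd.2.le
  rw [show F b - F A = F B - F a by linarith] at h2
  have h4 : Real.cos (k * B) - Real.cos (k * a) = (F B - F a) * k * -(Real.sin (k * c) / F' c) := by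
    field_simp
    linarith
  have h5 : Real.cos (k * b) - Real.cos (k * A) = (F B - F a) * k * -(Real.sin (k * d) / F' d) := by
    field_simp
    linarith
  have h6 : Real.sin (k * d) / F' d ≤ Real.sin (k * c) / F' c := by
    rw [div_le_div_iff₀ hfd hfc]
    linarith
  have h7 := mul_le_mul_of_nonneg_left h6 (mul_nonneg hΔ hk.le)
  linarith

/-- A flat or hyperbolic median law expresses `F A + F B` by the half base `h` and the median `D`.
The degenerate triangle with the same `h` and `D` has sides `|D - h|` and `D + h`, and its cosines
sum exactly to the spherical value. The triangle inequalities place `A` and `B` between these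
extremes. -/
theorem cos_add_cos_le_of_median {F F' : ℝ → ℝ} {k A B D h : ℝ} (hk : 0 < k)
    (hF : ∀ x, HasDerivAt F (F' x) x) (hpos : ∀ x, 0 < x → 0 < F' x)
    (hmono : StrictMonoOn F (Set.Ici 0)) (hb : k * (D + h) ≤ Real.pi)
    (hanti : ∀ x y, 0 < x → x ≤ y → y ≤ D + h →
      F' x * Real.sin (k * y) ≤ Real.sin (k * x) * F' y)
    (hA1 : A ≤ D + h) (hA2 : D ≤ A + h) (hA3 : h ≤ A + D)
    (hB1 : B ≤ D + h) (hB2 : D ≤ B + h) (hB3 : h ≤ B + D)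
    (hsum : F A + F B = F |D - h| + F (D + h)) :
    Real.cos (k * A) + Real.cos (k * B) ≤ 2 * Real.cos (k * h) * Real.cos (k * D) := by
  have hA : |D - h| ≤ A := abs_le.2 ⟨by linarith, by linarith⟩
  have hB : |D - h| ≤ B := abs_le.2 ⟨by linarith, by linarith⟩
  have key : Real.cos (k * A) + Real.cos (k * B) ≤
      Real.cos (k * |D - h|) + Real.cos (k * (D + h)) := by
    rcases le_total B A with hBA | hBA
    · exact cos_add_cos_le_of_add_eq hk hF hpos hmono hb hanti (abs_nonneg _) hB hBA hA1 hsum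
    · rw [add_comm (Real.cos (k * A))]
      exact cos_add_cos_le_of_add_eq hk hF hpos hmono hb hanti (abs_nonneg _) hA hBA hB1
        (by linarith)
  have e : Real.cos (k * |D - h|) = Real.cos (k * D - k * h) := by
    rw [← abs_of_pos hk, ← abs_mul, Real.cos_abs, abs_of_pos hk, mul_sub]
  rw [e, mul_add, Real.cos_add, Real.cos_sub] at key
  linarith

theorem mul_sin_le_sin_mul {k x y : ℝ} (hk : 0 < k) (hx : 0 < x) (hxy : x ≤ y)
    (hy : k * y ≤ Real.pi) : x * Real.sin (k * y) ≤ Real.sin (k * x) * y := by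
  have hy0 : 0 < y := hx.trans_le hxy
  have h0 : (0 : ℝ) ∈ Set.Icc 0 Real.pi := ⟨le_rfl, Real.pi_pos.le⟩
  have h1 : k * y ∈ Set.Icc 0 Real.pi := ⟨by positivity, hy⟩
  have h := strictConcaveOn_sin_Icc.concaveOn.2 h0 h1 (sub_nonneg.2 ((div_le_one hy0).2 hxy))
    (show 0 ≤ x / y by positivity) (by ring)
  simp only [smul_eq_mul, mul_zero, Real.sin_zero, zero_add] at h
  rw [show x / y * (k * y) = k * x by field_simp] at h
  have := mul_le_mul_of_nonneg_right h hy0.le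
  calc x * Real.sin (k * y) = x / y * Real.sin (k * y) * y := by field_simp
    _ ≤ _ := this

theorem sinh_mul_le_mul_sinh {x y : ℝ} (hx : 0 < x) (hxy : x ≤ y) :
    Real.sinh x * y ≤ x * Real.sinh y := by
  have hy0 : 0 < y := hx.trans_le hxy
  have hconv : ConvexOn ℝ (Set.Ici 0) Real.sinh := by
    refine MonotoneOn.convexOn_of_deriv (convex_Ici 0) Real.continuous_sinh.continuousOn
      Real.differentiable_sinh.differentiableOn ?_
    rw [Real.deriv_sinh]
    exact Real.cosh_strictMonoOn.monotoneOn.mono interior_subset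
  have h := hconv.2 (Set.self_mem_Ici (a := (0 : ℝ))) (Set.mem_Ici.2 hy0.le)
    (sub_nonneg.2 ((div_le_one hy0).2 hxy)) (show 0 ≤ x / y by positivity) (by ring)
  simp only [smul_eq_mul, mul_zero, Real.sinh_zero, zero_add] at h
  rw [show x / y * y = x by field_simp] at h
  have := mul_le_mul_of_nonneg_right h hy0.le
  calc Real.sinh x * y ≤ x / y * Real.sinh y * y := this
    _ = _ := by field_simp

/-- The midpoint comparison inequality with the sphere of curvature `k ^ 2`, at small scales,
together with the elementary properties of a distance. -/
structure HasMidpointComparison {Y : Type*} (d : Y → Y → ℝ) (k : ℝ) : Prop where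
  symm : ∀ P Q, d P Q = d Q P
  triangle : ∀ P Q R, d P R ≤ d P Q + d Q R
  midpoint : ∀ P Q Z N, d P N = d P Q / 2 → d N Q = d P Q / 2 → k * d Z P ≤ 1 → k * d Z Q ≤ 1 →
    k * d P Q ≤ 1 →
    Real.cos (k * d Z P) + Real.cos (k * d Z Q) ≤
      2 * Real.cos (k * d P Q / 2) * Real.cos (k * d Z N)

theorem hasMidpointComparison_sphere {R : ℝ} (hR : 0 < R) :
    HasMidpointComparison (Y := Metric.sphere (0 : EuclideanSpace ℝ (Fin 3)) R)
      (fun p q => R * InnerProductGeometry.angle p.1 q.1) R⁻¹ where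
  symm P Q := by rw [InnerProductGeometry.angle_comm]
  triangle P Q Z := by
    rw [← mul_add]
    exact mul_le_mul_of_nonneg_left (InnerProductGeometry.angle_le_angle_add_angle _ _ _) hR.le
  midpoint P Q Z N h1 h2 _ _ _ := by
    simp only [inv_mul_cancel_left₀ hR.ne']
    have hn : ∀ X : Metric.sphere (0 : EuclideanSpace ℝ (Fin 3)) R, ‖X.1‖ = R := fun X => by
      simp
    have hin : ∀ X Y : Metric.sphere (0 : EuclideanSpace ℝ (Fin 3)) R, inner ℝ X.1 Y.1 =
        R ^ 2 * Real.cos (InnerProductGeometry.angle X.1 Y.1) := fun X Y => by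
      rw [← InnerProductGeometry.cos_angle_mul_norm_mul_norm, hn, hn]
      ring
    have a1 : InnerProductGeometry.angle P.1 N.1 = InnerProductGeometry.angle P.1 Q.1 / 2 := by
      field_simp at h1 ⊢
      linarith
    have a2 : InnerProductGeometry.angle N.1 Q.1 = InnerProductGeometry.angle P.1 Q.1 / 2 := by
      field_simp at h2 ⊢
      linarith
    set θ := InnerProductGeometry.angle P.1 Q.1 with hθ
    have hc : Real.cos θ = 2 * Real.cos (θ / 2) ^ 2 - 1 := by
      rw [← Real.cos_two_mul]
      ring_nf
    -- On the sphere `P + Q` is the multiple `2 * cos (θ / 2)` of the midpoint. Pairing with `Z`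
    -- then gives equality, with no restriction on size.
    have hW : P.1 + Q.1 - (2 * Real.cos (θ / 2)) • N.1 = 0 := by
      rw [← inner_self_eq_zero (𝕜 := ℝ)]
      have i1 := hin P P
      have i2 := hin Q Q
      have i3 := hin N N
      have i4 := hin P Q
      have i5 := hin P N
      have i6 := hin N Q
      have hself : ∀ X : Metric.sphere (0 : EuclideanSpace ℝ (Fin 3)) R,
          InnerProductGeometry.angle X.1 X.1 = 0 := fun X =>
        InnerProductGeometry.angle_self (by rw [← norm_ne_zero_iff, hn]; exact hR.ne')
      rw [hself, Real.cos_zero] at i1 i2 i3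
      rw [← hθ, hc] at i4
      rw [a1] at i5
      rw [a2] at i6
      simp only [inner_sub_left, inner_sub_right, inner_add_left, inner_add_right,
        real_inner_smul_left, real_inner_smul_right]
      rw [real_inner_comm P.1 Q.1, real_inner_comm P.1 N.1, real_inner_comm N.1 Q.1,
        i1, i2, i3, i4, i5, i6]
      ring
    have hZ : inner ℝ Z.1 (P.1 + Q.1 - (2 * Real.cos (θ / 2)) • N.1) = 0 := by
      rw [hW, inner_zero_right]
    simp only [inner_sub_right, inner_add_right, real_inner_smul_right, hin] at hZ
    have hR2 : (0 : ℝ) < R ^ 2 := by positivity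
    have : R ^ 2 * (Real.cos (InnerProductGeometry.angle Z.1 P.1) +
        Real.cos (InnerProductGeometry.angle Z.1 Q.1)) =
        R ^ 2 * (2 * Real.cos (θ / 2) * Real.cos (InnerProductGeometry.angle Z.1 N.1)) := by
      linarith
    rw [mul_div_assoc, inv_mul_cancel_left₀ hR.ne'] at *
    exact (mul_left_cancel₀ hR2.ne' this).le

/-- Apollonius' theorem is the median law with `F x = x ^ 2`; the monotonicity required is that of
`sin (k * x) / x`. -/
theorem hasMidpointComparison_plane {k : ℝ} (hk : 0 < k) :
    HasMidpointComparison (Y := EuclideanSpace ℝ (Fin 2)) (fun p q => dist p q) k where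
  symm := dist_comm
  triangle := dist_triangle
  midpoint P Q Z N h1 h2 hP hQ hPQ := by
    have hN : N = midpoint ℝ P Q := eq_midpoint_of_dist_eq_half h1 h2
    have hap := EuclideanGeometry.dist_sq_add_dist_sq_eq_two_mul_dist_midpoint_sq_add_half_dist_sq
      Z P Q
    rw [← hN] at hap
    have t1 := dist_triangle Z P N
    have t2 := dist_triangle Z N P
    have t3 := dist_triangle P Z N
    have t4 := dist_triangle Z Q N
    have t5 := dist_triangle Z N Q
    have t6 := dist_triangle Q Z N
    rw [dist_comm N P] at t2
    rw [dist_comm P Z] at t3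
    rw [dist_comm Q N] at t4 t6
    rw [dist_comm Q Z] at t6
    rw [h1] at t1 t2 t3
    rw [h2] at t4 t5 t6
    have hb : k * (dist Z N + dist P Q / 2) ≤ Real.pi := by
      have := Real.pi_gt_three
      nlinarith
    have := cos_add_cos_le_of_median (F := fun x => x ^ 2) (F' := fun x => 2 * x) (k := k)
      (A := dist Z P) (B := dist Z Q) (D := dist Z N) (h := dist P Q / 2) hk
      (fun x => by simpa using hasDerivAt_pow 2 x) (fun x hx => by positivity)
      (fun x hx y hy hxy => pow_lt_pow_left₀ hxy hx two_ne_zero) hb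
      (fun x y hx hxy hy => by
        have := mul_sin_le_sin_mul hk hx hxy
          ((mul_le_mul_of_nonneg_left hy hk.le).trans hb)
        linarith)
      (by linarith) (by linarith) (by linarith) (by linarith) (by linarith) (by linarith)
      (by simp only [sq_abs]; linarith)
    rwa [← mul_div_assoc] at this

/-- In the hyperboloid model the point `x' + i x` has null-type coordinates `1 / x`, `x' / x`, `(x'
^ 2 + x ^ 2) / x`, and the Lorentz pairing is the hyperbolic cosine of the distance up to sign. The
identity evaluates the pairing of `Z` with `P + Q - 2 * c * N`. -/
theorem null_vector_pairing {p q n z : ℝ} (hp : 0 < p) (hq : 0 < q) (hn : 0 < n) (hz : 0 < z)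
    {p' q' n' z' c : ℝ} :
    (1 / p + 1 / q - 2 * c / n) * (z' ^ 2 + z ^ 2) + ((p' ^ 2 + p ^ 2) / p +
      (q' ^ 2 + q ^ 2) / q - 2 * c * (n' ^ 2 + n ^ 2) / n) -
      2 * z' * (p' / p + q' / q - 2 * c * n' / n) =
      2 * z * (((z' - p') ^ 2 + z ^ 2 + p ^ 2) / (2 * z * p) +
        ((z' - q') ^ 2 + z ^ 2 + q ^ 2) / (2 * z * q) -
        2 * c * (((z' - n') ^ 2 + z ^ 2 + n ^ 2) / (2 * z * n))) := by
  have h : ∀ x x' : ℝ, 0 < x → 2 * z * (((z' - x') ^ 2 + z ^ 2 + x ^ 2) / (2 * z * x)) =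
      1 / x * (z' ^ 2 + z ^ 2) + (x' ^ 2 + x ^ 2) / x - 2 * z' * (x' / x) := by
    intro x x' hx
    field_simp
    ring
  linear_combination (-1) * h p p' hp - h q q' hq + 2 * c * h n n' hn

/-- The vector `P + Q - 2 * c * N` is orthogonal to `N` (`f1`) and null (`f2`). Since `N` is
timelike, its orthogonal complement is definite, so the vector vanishes; `f3` is this definiteness
as a sum of two squares. -/
theorem lorentz_midpoint {p q n z : ℝ} (hp : 0 < p) (hq : 0 < q) (hn : 0 < n) (hz : 0 < z)
    {p' q' n' z' c : ℝ}
    (e1 : (p' - n') ^ 2 + p ^ 2 + n ^ 2 = c * (2 * p * n))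
    (e2 : (n' - q') ^ 2 + n ^ 2 + q ^ 2 = c * (2 * n * q))
    (e3 : (p' - q') ^ 2 + p ^ 2 + q ^ 2 = (2 * c ^ 2 - 1) * (2 * p * q)) :
    ((z' - p') ^ 2 + z ^ 2 + p ^ 2) / (2 * z * p) + ((z' - q') ^ 2 + z ^ 2 + q ^ 2) / (2 * z * q) =
      2 * c * (((z' - n') ^ 2 + z ^ 2 + n ^ 2) / (2 * z * n)) := by
  have f1 : (1 / p + 1 / q - 2 * c / n) * (n' ^ 2 + n ^ 2) + ((p' ^ 2 + p ^ 2) / p +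
      (q' ^ 2 + q ^ 2) / q - 2 * c * (n' ^ 2 + n ^ 2) / n) -
      2 * n' * (p' / p + q' / q - 2 * c * n' / n) = 0 := by
    have : (1 / p + 1 / q - 2 * c / n) * (n' ^ 2 + n ^ 2) + ((p' ^ 2 + p ^ 2) / p +
        (q' ^ 2 + q ^ 2) / q - 2 * c * (n' ^ 2 + n ^ 2) / n) -
        2 * n' * (p' / p + q' / q - 2 * c * n' / n) = ((p' - n') ^ 2 + p ^ 2 + n ^ 2) / p +
        ((n' - q') ^ 2 + n ^ 2 + q ^ 2) / q - 4 * c * n := by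
      field_simp
      ring
    rw [this, e1, e2]
    field_simp
    ring
  have f2 : (1 / p + 1 / q - 2 * c / n) * ((p' ^ 2 + p ^ 2) / p +
      (q' ^ 2 + q ^ 2) / q - 2 * c * (n' ^ 2 + n ^ 2) / n) -
      (p' / p + q' / q - 2 * c * n' / n) ^ 2 = 0 := by
    have : (1 / p + 1 / q - 2 * c / n) * ((p' ^ 2 + p ^ 2) / p +
        (q' ^ 2 + q ^ 2) / q - 2 * c * (n' ^ 2 + n ^ 2) / n) -
        (p' / p + q' / q - 2 * c * n' / n) ^ 2 = 2 + 4 * c ^ 2 +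
        ((p' - q') ^ 2 + p ^ 2 + q ^ 2) / (p * q) -
        2 * c * (((p' - n') ^ 2 + p ^ 2 + n ^ 2) / (p * n)) -
        2 * c * (((n' - q') ^ 2 + n ^ 2 + q ^ 2) / (n * q)) := by
      field_simp
      ring
    rw [this, e1, e2, e3]
    field_simp
    ring
  have key := null_vector_pairing hp hq hn hz (p' := p') (q' := q') (n' := n') (z' := z') (c := c)
  generalize 1 / p + 1 / q - 2 * c / n = W1 at *
  generalize (p' ^ 2 + p ^ 2) / p + (q' ^ 2 + q ^ 2) / q - 2 * c * (n' ^ 2 + n ^ 2) / n = W3 at *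
  generalize p' / p + q' / q - 2 * c * n' / n = W2 at *
  have f3 : (W1 * n' - W2) ^ 2 + (W1 * n) ^ 2 = 0 := by linear_combination W1 * f1 - f2
  have f4 : W1 = 0 := by
    have : (W1 * n) ^ 2 = 0 := by nlinarith [sq_nonneg (W1 * n' - W2), sq_nonneg (W1 * n)]
    exact (mul_eq_zero.1 (pow_eq_zero_iff two_ne_zero |>.1 this)).resolve_right hn.ne'
  have f5 : W2 = 0 := by
    have : W2 ^ 2 = 0 := by rw [f4] at f3; linear_combination f3
    exact pow_eq_zero_iff two_ne_zero |>.1 this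
  have f6 : W3 = 0 := by
    rw [f4, f5] at f1
    linarith
  rw [f4, f5, f6] at key
  have h0 : 2 * z * (((z' - p') ^ 2 + z ^ 2 + p ^ 2) / (2 * z * p) +
      ((z' - q') ^ 2 + z ^ 2 + q ^ 2) / (2 * z * q) -
      2 * c * (((z' - n') ^ 2 + z ^ 2 + n ^ 2) / (2 * z * n))) = 0 := by
    rw [← key]
    ring
  exact sub_eq_zero.1 ((mul_eq_zero.1 h0).resolve_left (by positivity))

theorem cosh_add_cosh_eq_of_midpoint {P Q Z N : UpperHalfPlane} (h1 : dist P N = dist P Q / 2)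
    (h2 : dist N Q = dist P Q / 2) : Real.cosh (dist Z P) + Real.cosh (dist Z Q) =
      2 * Real.cosh (dist P Q / 2) * Real.cosh (dist Z N) := by
  have e3 : Real.cosh (dist P Q) = 2 * Real.cosh (dist P Q / 2) ^ 2 - 1 := by
    have := Real.cosh_two_mul (dist P Q / 2)
    rw [Real.sinh_sq] at this
    rw [show dist P Q = 2 * (dist P Q / 2) by ring, this]
    ring_nf
  have e1 := congrArg Real.cosh h1
  have e2 := congrArg Real.cosh h2
  have hp := P.im_pos
  have hq := Q.im_pos
  have hz := Z.im_pos
  have hn := N.im_pos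
  generalize Real.cosh (dist P Q / 2) = c at *
  rw [UpperHalfPlane.cosh_dist', div_eq_iff (by positivity)] at e1 e2 e3
  rw [UpperHalfPlane.cosh_dist' Z P, UpperHalfPlane.cosh_dist' Z Q, UpperHalfPlane.cosh_dist' Z N]
  exact lorentz_midpoint hp hq hn hz e1 e2 e3

theorem hasMidpointComparison_hyperbolic {k r : ℝ} (hk : 0 < k) (hr : 0 < r) :
    HasMidpointComparison (Y := UpperHalfPlane) (fun p q => r * dist p q) k where
  symm P Q := by rw [dist_comm]
  triangle P Q Z := by
    rw [← mul_add]
    exact mul_le_mul_of_nonneg_left (dist_triangle _ _ _) hr.le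
  midpoint P Q Z N h1 h2 hP hQ hPQ := by
    simp only [← mul_assoc] at *
    have h1 : dist P N = dist P Q / 2 := by field_simp at h1 ⊢; linarith
    have h2 : dist N Q = dist P Q / 2 := by field_simp at h2 ⊢; linarith
    have hkr : 0 < k * r := by positivity
    have hap := cosh_add_cosh_eq_of_midpoint (Z := Z) h1 h2
    have t1 := dist_triangle Z P N
    have t2 := dist_triangle Z N P
    have t3 := dist_triangle P Z N
    have t4 := dist_triangle Z Q N
    have t5 := dist_triangle Z N Q
    have t6 := dist_triangle Q Z N
    rw [dist_comm N P] at t2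
    rw [dist_comm P Z] at t3
    rw [dist_comm Q N] at t4 t6
    rw [dist_comm Q Z] at t6
    rw [h1] at t1 t2 t3
    rw [h2] at t4 t5 t6
    have hb : k * r * (dist Z N + dist P Q / 2) ≤ Real.pi := by
      have := Real.pi_gt_three
      nlinarith
    have := cos_add_cos_le_of_median (F := Real.cosh) (F' := Real.sinh) (k := k * r)
      (A := dist Z P) (B := dist Z Q) (D := dist Z N) (h := dist P Q / 2) hkr
      Real.hasDerivAt_cosh (fun x hx => Real.sinh_pos_iff.2 hx) Real.cosh_strictMonoOn hb
      -- The quotient `sin (k * r * x) / sinh x` decreases, as the product of the decreasing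
      -- functions `sin (k * r * x) / x` and `x / sinh x`.
      (fun x y hx hxy hy => by
        have hy0 : 0 < y := hx.trans_le hxy
        have hpi := (mul_le_mul_of_nonneg_left hy hkr.le).trans hb
        have i1 := mul_sin_le_sin_mul hkr hx hxy hpi
        have i2 := sinh_mul_le_mul_sinh hx hxy
        have i3 : 0 ≤ Real.sin (k * r * y) :=
          Real.sin_nonneg_of_nonneg_of_le_pi (by positivity) hpi
        have i4 : 0 ≤ Real.sinh y := (Real.sinh_pos_iff.2 hy0).le
        refine le_of_mul_le_mul_right ?_ hy0
        nlinarith [mul_le_mul_of_nonneg_right i2 i3, mul_le_mul_of_nonneg_right i1 i4])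
      (by linarith) (by linarith) (by linarith) (by linarith) (by linarith) (by linarith)
      (by rw [Real.cosh_abs, Real.cosh_sub, Real.cosh_add]; linarith)
    rwa [← mul_div_assoc] at this

theorem hasMidpointComparison_modelPlane {κ k : ℝ} (hk : 0 < k) (hκ : 0 < κ → k = √κ) :
    HasMidpointComparison (modelPlane κ).2 k := by
  rcases lt_trichotomy κ 0 with h0 | h0 | h0
  · have e : modelPlane κ = ⟨UpperHalfPlane, fun p q => 1 / √(-κ) * dist p q⟩ := by
      unfold modelPlane
      rw [if_neg h0.le.not_gt, if_neg h0.ne]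
    rw [e]
    have : 0 < -κ := by linarith
    exact hasMidpointComparison_hyperbolic hk (by positivity)
  · have e : modelPlane κ = ⟨EuclideanSpace ℝ (Fin 2), fun p q => dist p q⟩ := by
      unfold modelPlane
      rw [if_neg h0.le.not_gt, if_pos h0]
    rw [e]
    exact hasMidpointComparison_plane hk
  · have e : modelPlane κ = ⟨Metric.sphere (0 : EuclideanSpace ℝ (Fin 3)) (1 / √κ),
        fun p q => 1 / √κ * InnerProductGeometry.angle p.1 q.1⟩ := by
      unfold modelPlane
      rw [if_pos h0]
    rw [e, hκ h0]
    have h := hasMidpointComparison_sphere (R := 1 / √κ) (by positivity)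
    rwa [show (1 / √κ)⁻¹ = √κ by simp] at h

/-! ### Midpoint comparison in spaces of bounded curvature -/

/-- `m` is a midpoint of `p` and `q`. -/
structure IsMidpoint {M : Type*} [MetricSpace M] (p q m : M) : Prop where
  left : dist p m = dist p q / 2
  right : dist m q = dist p q / 2

/-- The midpoint inequality of spaces of curvature at most `k ^ 2`, for the triangle with vertices
`z`, `p`, `q` and the midpoint `m` of `p` and `q`. -/
def MidpointInequality {M : Type*} [MetricSpace M] (k : ℝ) (z p q m : M) : Prop :=
  Real.cos (k * dist z p) + Real.cos (k * dist z q) ≤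
    2 * Real.cos (k * dist p q / 2) * Real.cos (k * dist z m)

/-- The midpoint inequality holds for all triangles of size smaller than `r`. -/
def HasLocalMidpointInequality (M : Type*) [MetricSpace M] (k r : ℝ) : Prop :=
  ∀ p q z m : M, dist p q < r → dist p z < r → IsMidpoint p q m → MidpointInequality k z p q m

theorem ofReal_pi_div_le_modelDiam {κ k : ℝ} (hκ : 0 < κ → k = √κ) :
    ENNReal.ofReal (Real.pi / k) ≤ modelDiam κ := by
  unfold modelDiam
  split_ifs with h
  · rw [hκ h]
  · exact le_top

theorem cos_one_le_imp_eq_zero {x : ℝ} (h0 : 0 ≤ x) (h1 : x ≤ Real.pi) (h : 1 ≤ Real.cos x) :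
    x = 0 :=
  Real.injOn_cos ⟨h0, h1⟩ ⟨le_rfl, Real.pi_pos.le⟩
    (by rw [Real.cos_zero]; exact le_antisymm (Real.cos_le_one _) h)

section Local

variable {M : Type*} [MetricSpace M]

theorem IsCATSpace.midpointInequality {κ k r : ℝ} {U : Set M} (hU : IsCATSpace κ U) (hk : 0 < k)
    (hκ : 0 < κ → k = √κ) (hr : k * r ≤ 1 / 2) {x : M} (hxU : Metric.ball x r ⊆ U)
    {p q : M} (hp : p ∈ Metric.ball x r) (hq : q ∈ Metric.ball x r) :
    ∃ m ∈ U, IsMidpoint p q m ∧ ∀ z ∈ Metric.ball x r, MidpointInequality k z p q m := by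
  have hmod := hasMidpointComparison_modelPlane hk hκ
  have hlt : ∀ a ∈ Metric.ball x r, ∀ b ∈ Metric.ball x r, k * dist a b < 1 := by
    intro a ha b hb
    have h1 := dist_triangle_right a b x
    rw [Metric.mem_ball] at ha hb
    have : dist a b < 2 * r := by linarith
    nlinarith
  have hgeo : ∀ (a b : U), a.1 ∈ Metric.ball x r → b.1 ∈ Metric.ball x r →
      ∃ γ : unitInterval → U, IsConstantSpeedGeodesic dist γ a b := by
    intro a b ha hb
    refine hU.exists_geodesic a b (lt_of_lt_of_le ?_ (ofReal_pi_div_le_modelDiam hκ))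
    rw [edist_dist, ENNReal.ofReal_lt_ofReal_iff (by positivity), lt_div_iff₀ hk]
    have := hlt a ha b hb
    have := Real.pi_gt_three
    rw [Subtype.dist_eq]
    linarith
  obtain ⟨γ₀, h₀⟩ := hgeo ⟨p, hxU hp⟩ ⟨q, hxU hq⟩ hp hq
  let half : unitInterval := ⟨1 / 2, by norm_num, by norm_num⟩
  have e1 := h₀.dist_eq 0 half
  have e2 := h₀.dist_eq half 1
  rw [h₀.source] at e1
  rw [h₀.target] at e2
  simp only [half, Subtype.dist_eq, Set.Icc.coe_zero, Set.Icc.coe_one] at e1 e2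
  norm_num [abs_of_pos, abs_of_neg] at e1 e2
  refine ⟨γ₀ half, (γ₀ half).2, ⟨by simp only [half]; linarith, by simp only [half]; linarith⟩,
    fun z hz => ?_⟩
  obtain ⟨γ₁, h₁⟩ := hgeo ⟨q, hxU hq⟩ ⟨z, hxU hz⟩ hq hz
  obtain ⟨γ₂, h₂⟩ := hgeo ⟨z, hxU hz⟩ ⟨p, hxU hp⟩ hz hp
  have hpq := hlt p hp q hq
  have hqz := hlt q hq z hz
  have hzp := hlt z hz p hp
  obtain ⟨v, η, htri, hside, hcmp⟩ := hU.comparison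
    ![⟨p, hxU hp⟩, ⟨q, hxU hq⟩, ⟨z, hxU hz⟩] ![γ₀, γ₁, γ₂]
    (by intro i; fin_cases i; exacts [h₀, h₁, h₂]) (by
      refine lt_of_lt_of_le ?_ (mul_le_mul_right (ofReal_pi_div_le_modelDiam hκ) 2)
      simp only [edist_dist, Matrix.cons_val_zero, Matrix.cons_val_one, Matrix.cons_val,
        Subtype.dist_eq]
      rw [← ENNReal.ofReal_add dist_nonneg dist_nonneg,
        ← ENNReal.ofReal_add (by positivity) dist_nonneg,
        show (2 : ℝ≥0∞) = ENNReal.ofReal 2 by simp, ← ENNReal.ofReal_mul (by norm_num),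
        ENNReal.ofReal_lt_ofReal_iff (by positivity), ← mul_div_assoc, lt_div_iff₀ hk]
      have := Real.pi_gt_three
      linarith)
  set D := (modelPlane κ).2 with hD
  have s0 : D (v 0) (v 1) = dist p q := hside 0
  have s1 : D (v 1) (v 2) = dist q z := hside 1
  have s2 : D (v 2) (v 0) = dist z p := hside 2
  have g1 := (htri 0).dist_eq 0 half
  have g2 := (htri 0).dist_eq half 1
  rw [(htri 0).source] at g1
  rw [(htri 0).target] at g2
  simp only [half, Set.Icc.coe_zero, Set.Icc.coe_one, zero_add] at g1 g2
  norm_num [abs_of_pos, abs_of_neg] at g1 g2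
  -- The midpoint of the first side is compared with the endpoint of the second side, which is the
  -- apex `z`.
  have hc := hcmp 0 1 half 1
  rw [(htri 1).target] at hc
  have hc : dist (γ₀ half : M) z ≤ D (η 0 half) (v 2) := by
    have := h₁.target
    simp only [Matrix.cons_val_zero, Matrix.cons_val_one, this] at hc
    exact hc
  rw [hmod.symm, dist_comm] at hc
  have hm := hmod.midpoint (v 0) (v 1) (v 2) (η 0 half) (by simp only [half]; linarith)
    (by simp only [half]; linarith) (by rw [s2]; exact hzp.le)
    (by rw [hmod.symm, s1]; exact hqz.le) (by rw [s0]; exact hpq.le)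
  have htr := hmod.triangle (v 2) (v 0) (η 0 half)
  rw [hmod.symm (v 2) (v 1), s0, s1, s2] at hm
  have hle : k * D (v 2) (η 0 half) ≤ Real.pi := by
    have : D (v 0) (η 0 half) = dist p q / 2 := by simp only [half]; linarith
    rw [this, s2] at htr
    have := Real.pi_gt_three
    nlinarith
  have hcos := Real.cos_le_cos_of_nonneg_of_le_pi (by positivity) hle
    (mul_le_mul_of_nonneg_left hc hk.le)
  have hpos : 0 < Real.cos (k * dist p q / 2) :=
    Real.cos_pos_of_mem_Ioo ⟨by have := Real.pi_gt_three; have := dist_nonneg (x := p) (y := q); nlinarith,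
      by have := Real.pi_gt_three; linarith⟩
  unfold MidpointInequality
  rw [dist_comm z q]
  refine hm.trans (mul_le_mul_of_nonneg_left hcos (by positivity))

theorem IsCurvatureBoundedAbove.exists_hasLocalMidpointInequality [CompactSpace M] {κ k : ℝ}
    (hM : IsCurvatureBoundedAbove κ M) (hk : 0 < k) (hκ : 0 < κ → k = √κ) :
    ∃ r > 0, k * r ≤ 1 / 2 ∧ HasLocalMidpointInequality M k r := by
  have hpt : ∀ x : M, ∃ r > 0, k * r ≤ 1 / 2 ∧ ∀ p ∈ Metric.ball x r, ∀ q ∈ Metric.ball x r,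
      ∀ z ∈ Metric.ball x r, ∀ m, IsMidpoint p q m → MidpointInequality k z p q m := by
    intro x
    obtain ⟨U, hUx, hU⟩ := hM.exists_nhds x
    obtain ⟨r₁, hr₁, hball⟩ := Metric.mem_nhds_iff.1 hUx
    set r := min r₁ (1 / (2 * k)) with hr
    have hr0 : 0 < r := by positivity
    have hkr : k * r ≤ 1 / 2 := by
      calc k * r ≤ k * (1 / (2 * k)) := mul_le_mul_of_nonneg_left (min_le_right _ _) hk.le
        _ = 1 / 2 := by field_simp
    refine ⟨r / 2, by positivity, by linarith [mul_pos hk hr0], fun p hp q hq z hz m hm => ?_⟩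
    have hsub : Metric.ball x (r / 2) ⊆ Metric.ball x r := Metric.ball_subset_ball (by linarith)
    obtain ⟨m', -, hm', hmid⟩ := hU.midpointInequality hk hκ hkr
      ((Metric.ball_subset_ball (min_le_left _ _)).trans hball) (hsub hp) (hsub hq)
    rw [Metric.mem_ball] at hp hq hz
    have hpq : dist p q < r := by linarith [dist_triangle_right p q x]
    have hmx : m ∈ Metric.ball x r := by
      rw [Metric.mem_ball]
      have := dist_triangle m p x
      rw [dist_comm m p, hm.left] at this
      linarith
    -- Taking the arbitrary midpoint `m` as apex forces `cos (k * dist m m') = 1`, so it agrees with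
    -- the one provided by the CAT neighbourhood. Halving the radius keeps `m` inside the larger
    -- ball.
    have h := hmid m hmx
    unfold MidpointInequality at h
    rw [dist_comm m p, hm.left, hm.right, ← mul_div_assoc] at h
    have hkpq : k * dist p q < 1 := by nlinarith
    have hpi := Real.pi_gt_three
    have hnn := mul_nonneg hk.le (dist_nonneg (x := p) (y := q))
    have hpos : 0 < Real.cos (k * dist p q / 2) :=
      Real.cos_pos_of_mem_Ioo ⟨by linarith, by linarith⟩
    have h1 : 1 ≤ Real.cos (k * dist m m') := by
      by_contra hlt
      push Not at hlt
      nlinarith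
    have hd : dist m m' ≤ dist p q := by
      have := dist_triangle m p m'
      rw [dist_comm m p, hm.left, hm'.left] at this
      linarith
    have h2 := cos_one_le_imp_eq_zero (by positivity) (by nlinarith) h1
    have h3 : dist m m' = 0 := (mul_eq_zero.1 h2).resolve_left hk.ne'
    rw [dist_eq_zero.1 h3]
    exact hmid z (hsub hz)
  rcases isEmpty_or_nonempty M with hE | ⟨⟨x₀⟩⟩
  · exact ⟨1 / (2 * k), by positivity, by field_simp; rfl, fun p => hE.elim p⟩
  choose r hr0 hkr hr using hpt
  obtain ⟨δ, hδ, hcov⟩ := lebesgue_number_lemma_of_metric (isCompact_univ (X := M))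
    (c := fun x => Metric.ball x (r x)) (fun x => Metric.isOpen_ball)
    (fun x _ => Set.mem_iUnion.2 ⟨x, Metric.mem_ball_self (hr0 x)⟩)
  refine ⟨min δ (r x₀), lt_min hδ (hr0 x₀),
    (mul_le_mul_of_nonneg_left (min_le_right _ _) hk.le).trans (hkr x₀),
    fun p q z m hpq hpz hm => ?_⟩
  obtain ⟨x, hx⟩ := hcov p (Set.mem_univ p)
  refine hr x p (hx (Metric.mem_ball_self hδ)) q (hx ?_) z (hx ?_) m hm
  · rw [Metric.mem_ball, dist_comm]
    exact hpq.trans_le (min_le_left _ _)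
  · rw [Metric.mem_ball, dist_comm]
    exact hpz.trans_le (min_le_left _ _)

/-! ### Geodesics -/

theorem IsConstantSpeedGeodesic.lipschitzWith {γ : unitInterval → M} {p q : M}
    (hγ : IsConstantSpeedGeodesic dist γ p q) : LipschitzWith (nndist p q) γ :=
  LipschitzWith.of_dist_le_mul fun s t => by
    rw [hγ.dist_eq, mul_comm, coe_nndist, Subtype.dist_eq, Real.dist_eq]

theorem IsConstantSpeedGeodesic.dist_source {γ : unitInterval → M} {p q : M}
    (hγ : IsConstantSpeedGeodesic dist γ p q) (t : unitInterval) :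
    dist p (γ t) = t * dist p q := by
  have := hγ.dist_eq 0 t
  rw [hγ.source] at this
  rw [this, Set.Icc.coe_zero, zero_sub, abs_neg, abs_of_nonneg t.2.1]

theorem IsConstantSpeedGeodesic.dist_target {γ : unitInterval → M} {p q : M}
    (hγ : IsConstantSpeedGeodesic dist γ p q) (t : unitInterval) :
    dist (γ t) q = (1 - t) * dist p q := by
  have := hγ.dist_eq t 1
  rw [hγ.target] at this
  rw [this, Set.Icc.coe_one, abs_sub_comm, abs_of_nonneg (sub_nonneg.2 t.2.2)]

/-- Parametrized by `k` times arc length, the midpoint inequality is the symmetric difference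
condition for `cos (k * dist z ·)`. Only points close to each `γ t` enter the hypothesis, which is
what makes globalization possible. -/
theorem IsConstantSpeedGeodesic.sin_interpolation_le {k : ℝ} (hk : 0 < k) {z p q : M}
    {γ : unitInterval → M} (hγ : IsConstantSpeedGeodesic dist γ p q) (hl : k * dist p q < Real.pi)
    (hloc : ∀ t, ∃ ε > 0, ∀ p' q', dist p' (γ t) < ε → dist q' (γ t) < ε →
      IsMidpoint p' q' (γ t) → MidpointInequality k z p' q' (γ t)) (t : unitInterval) :
    Real.sin ((1 - t) * (k * dist p q)) * Real.cos (k * dist z p) +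
        Real.sin (t * (k * dist p q)) * Real.cos (k * dist z q) ≤
      Real.sin (k * dist p q) * Real.cos (k * dist z (γ t)) := by
  set l := k * dist p q with hl_def
  have hl0 : 0 ≤ l := by positivity
  rcases hl0.eq_or_lt with h0 | hlpos
  · simp [← h0]
  have hdpos : 0 < dist p q := by
    by_contra h
    have : dist p q = 0 := le_antisymm (not_lt.1 h) dist_nonneg
    rw [hl_def, this, mul_zero] at hlpos
    exact lt_irrefl _ hlpos
  have h01 : (0 : ℝ) ≤ 1 := zero_le_one
  set σ : ℝ → M := fun u => γ (Set.projIcc 0 1 h01 (u / l)) with hσ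
  have hmem : ∀ u ∈ Set.Icc 0 l, u / l ∈ Set.Icc (0 : ℝ) 1 := fun u hu =>
    ⟨div_nonneg hu.1 hl0, (div_le_one hlpos).2 hu.2⟩
  have hσd : ∀ u ∈ Set.Icc 0 l, ∀ v ∈ Set.Icc 0 l, dist (σ u) (σ v) = |u - v| / k := by
    intro u hu v hv
    simp only [hσ]
    rw [hγ.dist_eq, Set.projIcc_of_mem h01 (hmem u hu), Set.projIcc_of_mem h01 (hmem v hv)]
    simp only
    rw [← sub_div, abs_div, abs_of_pos hlpos, hl_def]
    field_simp
  have hσc : Continuous σ :=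
    hγ.lipschitzWith.continuous.comp (continuous_projIcc.comp (continuous_id.div_const l))
  have hσ0 : σ 0 = p := by
    simp only [hσ, zero_div]
    rw [Set.projIcc_left]
    exact hγ.source
  have hσl : σ l = q := by
    simp only [hσ, div_self hlpos.ne']
    rw [Set.projIcc_right]
    exact hγ.target
  have ht : (t : ℝ) * l ∈ Set.Icc 0 l :=
    ⟨mul_nonneg t.2.1 hl0, by nlinarith [t.2.2]⟩
  have hσt : σ (t * l) = γ t := by
    simp only [hσ]
    rw [mul_div_cancel_right₀ _ hlpos.ne', Set.projIcc_val]
  have main := _root_.sin_interpolation_le (f := fun u => Real.cos (k * dist z (σ u)))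
    (a := 0) (b := l) (by linarith) (by fun_prop) (by
      intro s hs
      obtain ⟨ε, hε, H⟩ := hloc (Set.projIcc 0 1 h01 (s / l))
      refine ⟨k * ε, by positivity, fun h h0 h1 hm hp => ?_⟩
      have hs' : s ∈ Set.Icc 0 l := ⟨hs.1.le, hs.2.le⟩
      have d1 : dist (σ (s - h)) (σ s) = h / k := by
        rw [hσd _ hm _ hs', show s - h - s = -h by ring, abs_neg, abs_of_pos h0]
      have d2 : dist (σ (s + h)) (σ s) = h / k := by
        rw [hσd _ hp _ hs', show s + h - s = h by ring, abs_of_pos h0]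
      have d3 : dist (σ (s - h)) (σ (s + h)) = 2 * h / k := by
        rw [hσd _ hm _ hp, show s - h - (s + h) = -(2 * h) by ring, abs_neg,
          abs_of_pos (by linarith)]
      have hlt : h / k < ε := by rwa [div_lt_iff₀ hk, mul_comm]
      have := H (σ (s - h)) (σ (s + h)) (by rw [← d1] at hlt; exact hlt)
        (by rw [← d2] at hlt; exact hlt)
        ⟨by rw [d3]; exact d1.trans (by ring), by rw [d3, dist_comm]; exact d2.trans (by ring)⟩
      unfold MidpointInequality at this
      rw [d3, show k * (2 * h / k) / 2 = h by field_simp] at this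
      exact this) _ ht
  simp only [hσ0, hσl, hσt, sub_zero] at main
  rw [show l - t * l = (1 - t) * l by ring] at main
  exact main

theorem HasLocalMidpointInequality.sin_interpolation_le {k r : ℝ} (hk : 0 < k) (hkr : k * r ≤ 1 / 2)
    (hM : HasLocalMidpointInequality M k r) {z p q : M} {γ : unitInterval → M}
    (hγ : IsConstantSpeedGeodesic dist γ p q) (hpq : dist p q < r / 2) (hz : dist z p < r / 2)
    (t : unitInterval) :
    Real.sin ((1 - t) * (k * dist p q)) * Real.cos (k * dist z p) +
        Real.sin (t * (k * dist p q)) * Real.cos (k * dist z q) ≤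
      Real.sin (k * dist p q) * Real.cos (k * dist z (γ t)) := by
  have hpi := Real.pi_gt_three
  refine hγ.sin_interpolation_le hk (by nlinarith [dist_nonneg (x := p) (y := q)])
    (fun s => ?_) t
  have hs : dist (γ s) z < r := by
    have h1 := dist_triangle_left (γ s) z p
    rw [hγ.dist_source, dist_comm p z] at h1
    have : (s : ℝ) * dist p q ≤ dist p q :=
      mul_le_of_le_one_left dist_nonneg s.2.2
    linarith
  refine ⟨min (r / 2) (r - dist (γ s) z), lt_min ?_ (by linarith), fun p' q' hp' hq' hm => ?_⟩
  · exact lt_of_le_of_lt dist_nonneg hpq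
  · rw [lt_min_iff] at hp' hq'
    refine hM p' q' z (γ s) ?_ ?_ hm
    · have := dist_triangle_right p' q' (γ s)
      linarith
    · have := dist_triangle p' (γ s) z
      linarith

/-! ### Short geodesics and small balls. -/

theorem HasLocalMidpointInequality.geodesic_unique {k r : ℝ} (hk : 0 < k) (hkr : k * r ≤ 1 / 2)
    (hM : HasLocalMidpointInequality M k r) {p q : M} {γ γ' : unitInterval → M}
    (hγ : IsConstantSpeedGeodesic dist γ p q) (hγ' : IsConstantSpeedGeodesic dist γ' p q)
    (hpq : dist p q < r / 2) : γ = γ' := by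
  funext t
  have hpi := Real.pi_gt_three
  have hd : dist (γ' t) p ≤ dist p q := by
    rw [dist_comm, hγ'.dist_source]
    exact mul_le_of_le_one_left dist_nonneg t.2.2
  have hd2 : dist (γ t) p ≤ dist p q := by
    rw [dist_comm, hγ.dist_source]
    exact mul_le_of_le_one_left dist_nonneg t.2.2
  -- The apex is the point of the second geodesic at the same time. The addition formula makes the
  -- left side `sin l`, so the two points coincide.
  have h := hM.sin_interpolation_le hk hkr hγ hpq (hd.trans_lt hpq) t
  rw [dist_comm _ p, hγ'.dist_source, hγ'.dist_target] at h
  rcases (dist_nonneg (x := p) (y := q)).eq_or_lt with h0 | hpos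
  · rw [← h0] at hd hd2
    rw [dist_le_zero.1 hd, dist_le_zero.1 hd2]
  set l := k * dist p q with hl
  have hl0 : 0 < l := by positivity
  have hl1 : l < 1 := by nlinarith
  rw [show k * (t * dist p q) = t * l by rw [hl]; ring,
    show k * ((1 - t) * dist p q) = (1 - t) * l by rw [hl]; ring] at h
  have e : Real.sin ((1 - t) * l) * Real.cos (t * l) + Real.sin (t * l) * Real.cos ((1 - t) * l) =
      Real.sin l := by
    rw [mul_comm (Real.sin (t * l)), ← Real.sin_add]
    ring_nf
  rw [e] at h
  have hsin : 0 < Real.sin l := Real.sin_pos_of_pos_of_lt_pi hl0 (by linarith)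
  have h1 : 1 ≤ Real.cos (k * dist (γ' t) (γ t)) := by
    by_contra hlt
    push Not at hlt
    nlinarith
  have hd3 : dist (γ' t) (γ t) ≤ 2 * dist p q := by
    linarith [dist_triangle_right (γ' t) (γ t) p]
  have h2 := cos_one_le_imp_eq_zero (by positivity) (by nlinarith) h1
  exact (dist_eq_zero.1 ((mul_eq_zero.1 h2).resolve_left hk.ne')).symm

theorem HasLocalMidpointInequality.isGeodesicallyConvex_ball {k r : ℝ} (hk : 0 < k)
    (hkr : k * r ≤ 1 / 2) (hM : HasLocalMidpointInequality M k r)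
    (hgeo : ∀ x y : M, ∃ γ : unitInterval → M, IsConstantSpeedGeodesic dist γ x y)
    (x : M) {s : ℝ} (hs : s ≤ r / 4) : IsGeodesicallyConvex (Metric.ball x s) := by
  intro p hp q hq
  rw [Metric.mem_ball'] at hp hq
  have hpi := Real.pi_gt_three
  have hpq : dist p q < r / 2 := by linarith [dist_triangle_left p q x]
  have hs0 : 0 < s := dist_nonneg.trans_lt hp
  obtain ⟨γ₀, h₀⟩ := hgeo p q
  refine ⟨⟨γ₀, h₀, fun γ hγ => hM.geodesic_unique hk hkr hγ h₀ hpq⟩, fun γ hγ t => ?_⟩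
  rw [Metric.mem_ball']
  rcases (dist_nonneg (x := p) (y := q)).eq_or_lt with h0 | hpos
  · have h1 := hγ.dist_source t
    rw [← h0, mul_zero] at h1
    rwa [← dist_eq_zero.1 h1]
  have h := hM.sin_interpolation_le hk hkr hγ hpq (hp.trans (by linarith)) t
  set l := k * dist p q with hl
  have hl0 : 0 < l := by positivity
  have hl1 : l < 1 := by nlinarith
  have hsin : 0 < Real.sin l := Real.sin_pos_of_pos_of_lt_pi hl0 (by linarith)
  have a1 : 0 ≤ Real.sin ((1 - t) * l) :=
    Real.sin_nonneg_of_nonneg_of_le_pi (mul_nonneg (sub_nonneg.2 t.2.2) hl0.le)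
      (by nlinarith [t.2.1])
  have a2 : 0 ≤ Real.sin (t * l) :=
    Real.sin_nonneg_of_nonneg_of_le_pi (mul_nonneg t.2.1 hl0.le) (by nlinarith [t.2.2])
  have e : Real.sin l ≤ Real.sin ((1 - t) * l) + Real.sin (t * l) := by
    have : Real.sin l = Real.sin ((1 - t) * l) * Real.cos (t * l) +
        Real.cos ((1 - t) * l) * Real.sin (t * l) := by
      rw [← Real.sin_add]
      ring_nf
    rw [this]
    exact add_le_add (mul_le_of_le_one_right a1 (Real.cos_le_one _))
      (mul_le_of_le_one_left a2 (Real.cos_le_one _))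
  have hks : k * s ≤ 1 := by nlinarith
  have c0 : ∀ w, dist x w < s → Real.cos (k * s) < Real.cos (k * dist x w) := fun w hw =>
    Real.cos_lt_cos_of_nonneg_of_le_pi (by positivity) (by linarith)
      (mul_lt_mul_of_pos_left hw hk)
  have c1 := c0 p hp
  have c2 := c0 q hq
  have c3 : 0 < Real.cos (k * s) :=
    Real.cos_pos_of_mem_Ioo ⟨by nlinarith, by linarith⟩
  -- A common lower bound at both ends survives interpolation because the weights sum to at least
  -- `sin l`.
  obtain ⟨C, hC1, hC2⟩ : ∃ C, Real.cos (k * s) < C ∧ C ≤ Real.cos (k * dist x p) ∧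
      C ≤ Real.cos (k * dist x q) :=
    ⟨min (Real.cos (k * dist x p)) (Real.cos (k * dist x q)), lt_min c1 c2, min_le_left _ _,
      min_le_right _ _⟩
  by_contra hcon
  push Not at hcon
  have hd : dist x (γ t) ≤ 2 * r := by
    have h1 := dist_triangle x p (γ t)
    rw [hγ.dist_source] at h1
    have : (t : ℝ) * dist p q ≤ dist p q := mul_le_of_le_one_left dist_nonneg t.2.2
    linarith
  have c4 : Real.cos (k * dist x (γ t)) ≤ Real.cos (k * s) :=
    Real.cos_le_cos_of_nonneg_of_le_pi (by positivity) (by nlinarith)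
      (mul_le_mul_of_nonneg_left hcon hk.le)
  have b1 := mul_le_mul_of_nonneg_left hC2.1 a1
  have b2 := mul_le_mul_of_nonneg_left hC2.2 a2
  have b3 := mul_le_mul_of_nonneg_right e (c3.trans hC1).le
  have b4 := mul_le_mul_of_nonneg_left c4 hsin.le
  have b5 := mul_lt_mul_of_pos_left hC1 hsin
  linarith

theorem HasLocalMidpointInequality.convexityRadius_pos {k r : ℝ} (hk : 0 < k) (hr : 0 < r)
    (hkr : k * r ≤ 1 / 2) (hM : HasLocalMidpointInequality M k r)
    (hgeo : ∀ x y : M, ∃ γ : unitInterval → M, IsConstantSpeedGeodesic dist γ x y) :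
    0 < convexityRadius M := by
  refine lt_of_lt_of_le (ENNReal.ofReal_pos.2 (show 0 < r / 4 by positivity)) ?_
  refine le_iInf fun x => ?_
  unfold convexityRadiusAt
  exact le_iSup₂ (f := fun (s : ℝ) (_ : 0 < s ∧ ∀ t < s, IsGeodesicallyConvex (Metric.ball x t)) =>
    ENNReal.ofReal s) (r / 4)
    ⟨by positivity, fun s hs => hM.isGeodesicallyConvex_ball hk hkr hgeo x hs.le⟩

theorem isGeodesicallyConvex_ball_of_lt_convexityRadius {s : ℝ}
    (hs : ENNReal.ofReal s < convexityRadius M) (x : M) :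
    IsGeodesicallyConvex (Metric.ball x s) := by
  have h := hs.trans_le (iInf_le _ x)
  unfold convexityRadiusAt at h
  obtain ⟨r, h⟩ := lt_iSup_iff.1 h
  obtain ⟨⟨hr0, hr⟩, h⟩ := lt_iSup_iff.1 h
  exact hr s ((ENNReal.ofReal_lt_ofReal_iff hr0).1 h)

end Local

/-! ### The Euclidean cone -/

section Cone

variable {M : Type*} [MetricSpace M]

/-- The square of the distance in the Euclidean cone over `(M, k • dist)`. -/
noncomputable def coneDistSq (k : ℝ) (P Q : ℝ × M) : ℝ :=
  P.1 ^ 2 + Q.1 ^ 2 - 2 * P.1 * Q.1 * Real.cos (k * dist P.2 Q.2)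

theorem coneDistSq_comm (k : ℝ) (P Q : ℝ × M) : coneDistSq k P Q = coneDistSq k Q P := by
  unfold coneDistSq
  rw [dist_comm]
  ring

theorem coneDistSq_self (k : ℝ) (P : ℝ × M) : coneDistSq k P P = 0 := by
  unfold coneDistSq
  rw [dist_self, mul_zero, Real.cos_zero]
  ring

theorem coneDistSq_nonneg {k : ℝ} {P Q : ℝ × M} (hP : 0 ≤ P.1) (hQ : 0 ≤ Q.1) :
    0 ≤ coneDistSq k P Q := by
  unfold coneDistSq
  have := mul_le_mul_of_nonneg_left (Real.cos_le_one (k * dist P.2 Q.2)) (mul_nonneg hP hQ)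
  nlinarith [sq_nonneg (P.1 - Q.1)]

/-- The law of cosines for the planar points with polar coordinates `(a, -α)`, `(b, 0)`, `(c, β)`.
-/
theorem sqrt_polar_triangle (a b c α β : ℝ) :
    √(a ^ 2 + c ^ 2 - 2 * a * c * Real.cos (α + β)) ≤
      √(a ^ 2 + b ^ 2 - 2 * a * b * Real.cos α) + √(b ^ 2 + c ^ 2 - 2 * b * c * Real.cos β) := by
  have h := norm_add_le (⟨a * Real.cos α - b, -(a * Real.sin α)⟩ : ℂ)
    ⟨b - c * Real.cos β, -(c * Real.sin β)⟩
  have ha := Real.sin_sq_add_cos_sq α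
  have hb := Real.sin_sq_add_cos_sq β
  simp only [Complex.norm_def, Complex.normSq_apply, Complex.add_re, Complex.add_im] at h
  convert h using 2
  · rw [Real.cos_add]
    linear_combination (-a ^ 2) * ha - c ^ 2 * hb
  · congr 1
    linear_combination (-a ^ 2) * ha
  · congr 1
    linear_combination (-c ^ 2) * hb

/-- Unrolling the two sectors into the plane can only enlarge the outer angle. The bound by `π` is
needed for the monotonicity of the cosine, since `coneDistSq` does not truncate angles. -/
theorem sqrt_coneDistSq_triangle {k : ℝ} (hk : 0 ≤ k) {P Q W : ℝ × M} (hP : 0 ≤ P.1) (hW : 0 ≤ W.1)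
    (h : k * (dist P.2 Q.2 + dist Q.2 W.2) ≤ Real.pi) :
    √(coneDistSq k P W) ≤ √(coneDistSq k P Q) + √(coneDistSq k Q W) := by
  refine le_trans (Real.sqrt_le_sqrt ?_) (sqrt_polar_triangle P.1 Q.1 W.1 _ _)
  unfold coneDistSq
  have : Real.cos (k * dist P.2 Q.2 + k * dist Q.2 W.2) ≤ Real.cos (k * dist P.2 W.2) := by
    rw [← mul_add]
    exact Real.cos_le_cos_of_nonneg_of_le_pi (by positivity) h
      (mul_le_mul_of_nonneg_left (dist_triangle _ _ _) hk)
  have := mul_le_mul_of_nonneg_left this (mul_nonneg hP hW)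
  linarith

theorem sqrt_mul_cos_arctan {X Y : ℝ} (hX : 0 < X) :
    √(X ^ 2 + Y ^ 2) * Real.cos (Real.arctan (Y / X)) = X := by
  rw [Real.cos_arctan, show 1 + (Y / X) ^ 2 = (X ^ 2 + Y ^ 2) / X ^ 2 by field_simp,
    Real.sqrt_div (by positivity), Real.sqrt_sq hX.le]
  have : 0 < √(X ^ 2 + Y ^ 2) := by positivity
  field_simp

theorem sqrt_mul_sin_arctan {X Y : ℝ} (hX : 0 < X) :
    √(X ^ 2 + Y ^ 2) * Real.sin (Real.arctan (Y / X)) = Y := by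
  rw [Real.sin_arctan, show 1 + (Y / X) ^ 2 = (X ^ 2 + Y ^ 2) / X ^ 2 by field_simp,
    Real.sqrt_div (by positivity), Real.sqrt_sq hX.le]
  have : 0 < √(X ^ 2 + Y ^ 2) := by positivity
  field_simp

theorem arctan_chord_mem {a b l t : ℝ} (ha : 0 < a) (hb : 0 < b) (hl0 : 0 ≤ l)
    (hl : l < Real.pi / 2) (ht : t ∈ Set.Icc (0 : ℝ) 1) :
    0 < (1 - t) * a + t * b * Real.cos l ∧
      Real.arctan (t * b * Real.sin l / ((1 - t) * a + t * b * Real.cos l)) ∈ Set.Icc 0 l := by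
  have hc : 0 < Real.cos l := Real.cos_pos_of_mem_Ioo ⟨by linarith [Real.pi_pos], hl⟩
  have hs : 0 ≤ Real.sin l := Real.sin_nonneg_of_nonneg_of_le_pi hl0 (by linarith [Real.pi_pos])
  have h1 : 0 ≤ 1 - t := sub_nonneg.2 ht.2
  have hX : 0 < (1 - t) * a + t * b * Real.cos l := by
    rcases ht.1.eq_or_lt with h | h
    · rw [← h]
      simpa using ha
    · have : 0 < t * b * Real.cos l := by positivity
      have : 0 ≤ (1 - t) * a := by positivity
      linarith
  refine ⟨hX, Real.arctan_nonneg.2 (div_nonneg (mul_nonneg (mul_nonneg ht.1 hb.le) hs) hX.le), ?_⟩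
  conv_rhs => rw [← Real.arctan_tan (by linarith [Real.pi_pos]) hl]
  refine Real.arctan_strictMono.monotone ?_
  rw [Real.tan_eq_sin_div_cos, div_le_div_iff₀ hX hc]
  have : 0 ≤ (1 - t) * a * Real.sin l := by positivity
  linarith

/-- Points on a chord of the cone over a small geodesic satisfy the inequality of
nonpositive curvature. -/
theorem HasLocalMidpointInequality.exists_cone_chord {k r : ℝ} (hk : 0 < k) (hkr : k * r ≤ 1 / 2)
    (hM : HasLocalMidpointInequality M k r)
    (hgeo : ∀ x y : M, ∃ γ : unitInterval → M, IsConstantSpeedGeodesic dist γ x y)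
    {P Q : ℝ × M} (hP : 0 < P.1) (hQ : 0 < Q.1) (hPQ : dist P.2 Q.2 < r / 2) {t : ℝ}
    (ht : t ∈ Set.Icc (0 : ℝ) 1) :
    ∃ N : ℝ × M, 0 ≤ N.1 ∧ dist P.2 N.2 ≤ dist P.2 Q.2 ∧ ∀ Z : ℝ × M, 0 ≤ Z.1 →
      dist Z.2 P.2 < r / 2 → coneDistSq k Z N ≤
        (1 - t) * coneDistSq k Z P + t * coneDistSq k Z Q - t * (1 - t) * coneDistSq k P Q := by
  obtain ⟨γ, hγ⟩ := hgeo P.2 Q.2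
  obtain ⟨a, p⟩ := P
  obtain ⟨b, q⟩ := Q
  simp only at *
  set l := k * dist p q with hl
  have hpi := Real.pi_gt_three
  have hl0 : 0 ≤ l := by positivity
  have hl1 : l < Real.pi / 2 := by nlinarith
  obtain ⟨hX, hθ0, hθl⟩ := arctan_chord_mem hP hQ hl0 hl1 ht
  set X := (1 - t) * a + t * b * Real.cos l with hXdef
  set Y := t * b * Real.sin l with hYdef
  set θ := Real.arctan (Y / X) with hθ
  set R := √(X ^ 2 + Y ^ 2) with hR
  have hRc : R * Real.cos θ = X := sqrt_mul_cos_arctan hX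
  have hRs : R * Real.sin θ = Y := sqrt_mul_sin_arctan hX
  have hR0 : 0 ≤ R := Real.sqrt_nonneg _
  have hR2 : R ^ 2 = X ^ 2 + Y ^ 2 := Real.sq_sqrt (by positivity)
  have hsc := Real.sin_sq_add_cos_sq l
  -- Over a single point the cone is a ray and equality holds; the parameter `θ / l` below would be
  -- meaningless.
  rcases hl0.eq_or_lt with h0 | hlpos
  · have hpq : p = q := dist_eq_zero.1 ((mul_eq_zero.1 h0.symm).resolve_left hk.ne')
    refine ⟨(R, p), hR0, by simp, fun Z hZ _ => ?_⟩
    have hY0 : Y = 0 := by rw [hYdef, ← h0, Real.sin_zero, mul_zero]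
    have hX0 : X = (1 - t) * a + t * b := by rw [hXdef, ← h0, Real.cos_zero, mul_one]
    have hRX : R = X := by rw [hR, hY0, zero_pow two_ne_zero, add_zero, Real.sqrt_sq hX.le]
    unfold coneDistSq
    simp only [← hpq, dist_self, mul_zero, Real.cos_zero]
    rw [hRX, hX0]
    apply le_of_eq
    ring
  have hθl1 : θ / l ∈ Set.Icc (0 : ℝ) 1 := ⟨by positivity, (div_le_one hlpos).2 hθl⟩
  refine ⟨(R, γ ⟨θ / l, hθl1⟩), hR0, ?_, fun Z hZ hZP => ?_⟩
  · rw [hγ.dist_source]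
    exact mul_le_of_le_one_left dist_nonneg hθl1.2
  have hint := hM.sin_interpolation_le hk hkr hγ hPQ hZP ⟨θ / l, hθl1⟩
  simp only at hint
  rw [← hl, div_mul_cancel₀ _ hlpos.ne', show (1 - θ / l) * l = l - θ by field_simp,
    Real.sin_sub] at hint
  have hsin : 0 < Real.sin l := Real.sin_pos_of_pos_of_lt_pi hlpos (by linarith)
  have h2 := mul_le_mul_of_nonneg_left hint hR0
  set ca := Real.cos (k * dist Z.2 p)
  set cb := Real.cos (k * dist Z.2 q)
  set cn := Real.cos (k * dist Z.2 (γ ⟨θ / l, hθl1⟩)) with hcn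
  -- Multiplied by the radius, the sinusoidal weights become Cartesian coordinates of the chord
  -- point, and the spherical inequality becomes affine in `t`.
  have h3 : Real.sin l * ((1 - t) * a * ca + t * b * cb) ≤ Real.sin l * (R * cn) := by
    calc Real.sin l * ((1 - t) * a * ca + t * b * cb)
        = (Real.sin l * (R * Real.cos θ) - Real.cos l * (R * Real.sin θ)) * ca +
          (R * Real.sin θ) * cb := by rw [hRc, hRs, hXdef, hYdef]; ring
      _ = R * ((Real.sin l * Real.cos θ - Real.cos l * Real.sin θ) * ca +
          Real.sin θ * cb) := by ring
      _ ≤ R * (Real.sin l * cn) := h2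
      _ = Real.sin l * (R * cn) := by ring
  have h4 := mul_le_mul_of_nonneg_left (le_of_mul_le_mul_left h3 hsin) hZ
  unfold coneDistSq
  simp only
  rw [← hl, hR2, hXdef, hYdef]
  linear_combination 2 * h4 + t ^ 2 * b ^ 2 * hsc

/-- `N` is a midpoint of `P` and `Q` in the cone, in the sense that it satisfies the inequality of
nonpositive curvature at small scales. -/
structure IsConeMidpoint (k r : ℝ) (P Q N : ℝ × M) : Prop where
  nonneg : 0 ≤ N.1
  dist_le : dist P.2 N.2 ≤ dist P.2 Q.2
  coneDistSq_le : ∀ Z : ℝ × M, 0 ≤ Z.1 → dist Z.2 P.2 < r / 2 →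
    coneDistSq k Z N ≤ (coneDistSq k Z P + coneDistSq k Z Q) / 2 - coneDistSq k P Q / 4

theorem HasLocalMidpointInequality.exists_isConeMidpoint {k r : ℝ} (hk : 0 < k)
    (hkr : k * r ≤ 1 / 2) (hM : HasLocalMidpointInequality M k r)
    (hgeo : ∀ x y : M, ∃ γ : unitInterval → M, IsConstantSpeedGeodesic dist γ x y)
    {P Q : ℝ × M} (hP : 0 < P.1) (hQ : 0 < Q.1) (hPQ : dist P.2 Q.2 < r / 2) :
    ∃ N, IsConeMidpoint k r P Q N := by
  obtain ⟨N, h0, h1, h2⟩ := hM.exists_cone_chord hk hkr hgeo hP hQ hPQ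
    (t := 1 / 2) ⟨by norm_num, by norm_num⟩
  exact ⟨N, h0, h1, fun Z hZ hZP => (h2 Z hZ hZP).trans (le_of_eq (by ring))⟩

/-- The chord between two points at radius `1` has its midpoint at radius `cos (k * dist x y / 2)`.
This version lets the base point be a prescribed midpoint `m`. -/
theorem HasLocalMidpointInequality.isConeMidpoint {k r : ℝ} (hk : 0 < k) (hkr : k * r ≤ 1 / 2)
    (hM : HasLocalMidpointInequality M k r) {x y m : M} (hxy : dist x y < r / 2)
    (hm : IsMidpoint x y m) :
    IsConeMidpoint k r (1, x) (1, y) (Real.cos (k * dist x y / 2), m) := by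
  have hpi := Real.pi_gt_three
  have hd := dist_nonneg (x := x) (y := y)
  have hkd : 0 ≤ k * dist x y := by positivity
  have hlt : k * dist x y < 1 := by nlinarith
  refine ⟨Real.cos_nonneg_of_mem_Icc ⟨by linarith, by linarith⟩, by simp only; rw [hm.left]; linarith,
    fun Z hZ hZx => ?_⟩
  simp only at hZx
  have h := mul_le_mul_of_nonneg_left
    (hM x y Z.2 m (by linarith) (by rw [dist_comm]; linarith) hm) hZ
  have hc : Real.cos (k * dist x y) = 2 * Real.cos (k * dist x y / 2) ^ 2 - 1 := by
    rw [← Real.cos_two_mul]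
    ring_nf
  unfold coneDistSq
  simp only
  rw [hc]
  linear_combination h

/-- The quadrilateral inequality of nonpositive curvature. The diagonal from `P` to `Q'` is divided
in the ratio of the sides `P Q` and `P' Q'`, and the other diagonal is routed through the division
point. The `ε` keeps the ratio defined when a side degenerates. -/
theorem HasLocalMidpointInequality.coneDistSq_diagonals_le {k r : ℝ} (hk : 0 < k)
    (hkr : k * r ≤ 1 / 2) (hM : HasLocalMidpointInequality M k r)
    (hgeo : ∀ x y : M, ∃ γ : unitInterval → M, IsConstantSpeedGeodesic dist γ x y)
    {P Q P' Q' : ℝ × M} (hP : 0 < P.1) (hQ : 0 < Q.1) (hP' : 0 < P'.1) (hQ' : 0 < Q'.1)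
    (h1 : dist P.2 Q.2 < r / 4) (h2 : dist P.2 P'.2 < r / 4) (h3 : dist P.2 Q'.2 < r / 4) :
    coneDistSq k P Q' + coneDistSq k Q P' ≤ coneDistSq k P P' + coneDistSq k Q Q' +
      2 * √(coneDistSq k P Q) * √(coneDistSq k P' Q') := by
  have hr : 0 < r := by linarith [dist_nonneg (x := P.2) (y := Q.2)]
  have hpi := Real.pi_gt_three
  set u := √(coneDistSq k P Q) with hu
  set u' := √(coneDistSq k P' Q') with hu'
  have hu0 : 0 ≤ u := Real.sqrt_nonneg _
  have hu0' : 0 ≤ u' := Real.sqrt_nonneg _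
  have hu2 : u ^ 2 = coneDistSq k P Q := Real.sq_sqrt (coneDistSq_nonneg hP.le hQ.le)
  have hu2' : u' ^ 2 = coneDistSq k P' Q' := Real.sq_sqrt (coneDistSq_nonneg hP'.le hQ'.le)
  have key : ∀ ε, 0 < ε → coneDistSq k P Q' + coneDistSq k Q P' ≤
      coneDistSq k P P' + coneDistSq k Q Q' + 2 * (u + ε) * (u' + ε) := by
    intro ε hε
    set v := u + ε with hv
    set v' := u' + ε with hv'
    have hv0 : 0 < v := by positivity
    have hv0' : 0 < v' := by positivity
    have ht : v / (v + v') ∈ Set.Icc (0 : ℝ) 1 :=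
      ⟨by positivity, (div_le_one (by positivity)).2 (by linarith)⟩
    obtain ⟨N, hN0, hNd, hN⟩ := hM.exists_cone_chord hk hkr hgeo hP hQ' (by linarith) ht
    have i1 := hN Q hQ.le (by rw [dist_comm]; linarith)
    have i2 := hN P' hP'.le (by rw [dist_comm]; linarith)
    have i3 := sqrt_coneDistSq_triangle hk.le (P := Q) (Q := N) (W := P') hQ.le hP'.le (by
      have t1 := dist_triangle_left Q.2 N.2 P.2
      have t2 := dist_triangle_left N.2 P'.2 P.2
      nlinarith)
    have i4 : coneDistSq k Q P' ≤ (√(coneDistSq k Q N) + √(coneDistSq k N P')) ^ 2 := by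
      rw [← Real.sq_sqrt (coneDistSq_nonneg (k := k) hQ.le hP'.le)]
      exact pow_le_pow_left₀ (Real.sqrt_nonneg _) i3 2
    have i5 : (√(coneDistSq k Q N) + √(coneDistSq k N P')) ^ 2 ≤
        (v + v') / v * coneDistSq k Q N + (v + v') / v' * coneDistSq k N P' := by
      have e1 := Real.sq_sqrt (coneDistSq_nonneg (k := k) hQ.le hN0)
      have e2 := Real.sq_sqrt (coneDistSq_nonneg (k := k) hN0 hP'.le)
      set α := √(coneDistSq k Q N)
      set β := √(coneDistSq k N P')
      rw [← e1, ← e2]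
      have : (v + v') / v * α ^ 2 + (v + v') / v' * β ^ 2 - (α + β) ^ 2 =
          (v' * α - v * β) ^ 2 / (v * v') := by
        field_simp
        ring
      have : 0 ≤ (v' * α - v * β) ^ 2 / (v * v') := by positivity
      linarith
    rw [coneDistSq_comm k N P'] at i4 i5
    have e3 : 1 - v / (v + v') = v' / (v + v') := by
      field_simp
      ring
    rw [e3] at i1 i2
    have j1 := mul_le_mul_of_nonneg_left i1 (show 0 ≤ (v + v') / v by positivity)
    have j2 := mul_le_mul_of_nonneg_left i2 (show 0 ≤ (v + v') / v' by positivity)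
    rw [coneDistSq_comm k Q P, ← hu2] at j1
    rw [← hu2', coneDistSq_comm k P' P] at j2
    have k1 : (v + v') / v * (v' / (v + v') * u ^ 2 + v / (v + v') * coneDistSq k Q Q' -
        v / (v + v') * (v' / (v + v')) * coneDistSq k P Q') =
        v' / v * u ^ 2 + coneDistSq k Q Q' - v' / (v + v') * coneDistSq k P Q' := by
      field_simp
    have k2 : (v + v') / v' * (v' / (v + v') * coneDistSq k P P' + v / (v + v') * u' ^ 2 -
        v / (v + v') * (v' / (v + v')) * coneDistSq k P Q') =
        coneDistSq k P P' + v / v' * u' ^ 2 - v / (v + v') * coneDistSq k P Q' := by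
      field_simp
    have k3 : v' / (v + v') * coneDistSq k P Q' + v / (v + v') * coneDistSq k P Q' =
        coneDistSq k P Q' := by
      field_simp
      ring
    have k4 : v' / v * u ^ 2 ≤ v * v' := by
      have : v' / v * u ^ 2 ≤ v' / v * v ^ 2 :=
        mul_le_mul_of_nonneg_left (pow_le_pow_left₀ hu0 (by linarith) 2) (by positivity)
      refine this.trans (le_of_eq ?_)
      field_simp
    have k5 : v / v' * u' ^ 2 ≤ v * v' := by
      have : v / v' * u' ^ 2 ≤ v / v' * v' ^ 2 :=
        mul_le_mul_of_nonneg_left (pow_le_pow_left₀ hu0' (by linarith) 2) (by positivity)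
      refine this.trans (le_of_eq ?_)
      field_simp
    linarith
  have hcont : Filter.Tendsto (fun ε : ℝ => coneDistSq k P P' + coneDistSq k Q Q' +
      2 * (u + ε) * (u' + ε)) (𝓝[>] 0)
      (𝓝 (coneDistSq k P P' + coneDistSq k Q Q' + 2 * (u + 0) * (u' + 0))) :=
    ((by fun_prop : Continuous fun ε : ℝ => coneDistSq k P P' + coneDistSq k Q Q' +
      2 * (u + ε) * (u' + ε)).tendsto 0).mono_left nhdsWithin_le_nhds
  rw [add_zero, add_zero] at hcont
  exact ge_of_tendsto hcont (by filter_upwards [self_mem_nhdsWithin] with ε hε using key ε hε)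

/-- Three midpoint inequalities, for `N'` seen from `N` and for `N` seen from `P'` and `Q'`, leave
the two diagonals to be bounded. The retained square of the difference of the sides is what sums to
the term of the large triangle. -/
theorem HasLocalMidpointInequality.coneDistSq_midpoints_le {k r : ℝ} (hk : 0 < k)
    (hkr : k * r ≤ 1 / 2) (hM : HasLocalMidpointInequality M k r)
    (hgeo : ∀ x y : M, ∃ γ : unitInterval → M, IsConstantSpeedGeodesic dist γ x y)
    {P Q P' Q' N N' : ℝ × M} (hP : 0 < P.1) (hQ : 0 < Q.1) (hP' : 0 < P'.1) (hQ' : 0 < Q'.1)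
    (h1 : dist P.2 Q.2 < r / 8) (h2 : dist P.2 P'.2 < r / 8) (h3 : dist P'.2 Q'.2 < r / 8)
    (hN : IsConeMidpoint k r P Q N) (hN' : IsConeMidpoint k r P' Q' N') :
    coneDistSq k N N' ≤ (coneDistSq k P P' + coneDistSq k Q Q') / 2 -
      (√(coneDistSq k P Q) - √(coneDistSq k P' Q')) ^ 2 / 4 := by
  have hr : 0 < r := by linarith [dist_nonneg (x := P.2) (y := Q.2)]
  have hPQ' : dist P.2 Q'.2 < r / 4 := by
    linarith [dist_triangle P.2 P'.2 Q'.2]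
  have hd := hM.coneDistSq_diagonals_le hk hkr hgeo hP hQ hP' hQ' (by linarith) (by linarith) hPQ'
  have d1 := hN'.coneDistSq_le N hN.nonneg (by
    have := dist_triangle_left N.2 P'.2 P.2
    linarith [hN.dist_le])
  have d2 := hN.coneDistSq_le P' hP'.le (by rw [dist_comm]; linarith)
  have d3 := hN.coneDistSq_le Q' hQ'.le (by rw [dist_comm]; linarith)
  rw [coneDistSq_comm k N P', coneDistSq_comm k N Q'] at d1
  rw [coneDistSq_comm k P' P, coneDistSq_comm k P' Q] at d2
  rw [coneDistSq_comm k Q' P, coneDistSq_comm k Q' Q] at d3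
  have e1 := Real.sq_sqrt (coneDistSq_nonneg (k := k) hP.le hQ.le)
  have e2 := Real.sq_sqrt (coneDistSq_nonneg (k := k) hP'.le hQ'.le)
  set u := √(coneDistSq k P Q)
  set u' := √(coneDistSq k P' Q')
  rw [← e1] at d2 d3
  rw [← e2] at d1
  nlinarith

/-- The inequality of nonpositive curvature in the cone for a thin triangle, by subdivision
into small quadrilaterals. -/
theorem HasLocalMidpointInequality.coneDistSq_chain_le {k r : ℝ} (hk : 0 < k)
    (hkr : k * r ≤ 1 / 2) (hM : HasLocalMidpointInequality M k r)
    (hgeo : ∀ x y : M, ∃ γ : unitInterval → M, IsConstantSpeedGeodesic dist γ x y)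
    {n : ℕ} {P Q N : ℕ → ℝ × M} {a b : ℝ} (hP : ∀ i ≤ n, 0 < (P i).1) (hQ : ∀ i ≤ n, 0 < (Q i).1)
    (hPQ : ∀ i ≤ n, dist (P i).2 (Q i).2 < r / 8)
    (hPP : ∀ i < n, dist (P i).2 (P (i + 1)).2 < r / 8)
    (hfar : ∀ i ≤ n, k * dist (P 0).2 (P i).2 ≤ 2)
    (hstart : P 0 = Q 0) (ha : ∀ i < n, coneDistSq k (P i) (P (i + 1)) = a / n ^ 2)
    (hb : ∀ i < n, coneDistSq k (Q i) (Q (i + 1)) = b / n ^ 2)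
    (hN : ∀ i ≤ n, IsConeMidpoint k r (P i) (Q i) (N i)) (hn : 0 < n) :
    coneDistSq k (P 0) (N n) ≤ (a + b) / 2 - coneDistSq k (P n) (Q n) / 4 := by
  have hpi := Real.pi_gt_three
  set u : ℕ → ℝ := fun i => √(coneDistSq k (P i) (Q i)) with hu
  set d : ℕ → ℝ := fun i => √(coneDistSq k (N i) (N (i + 1))) with hd
  have hr : 0 < r := by linarith [dist_nonneg (x := (P 0).2) (y := (Q 0).2), hPQ 0 (Nat.zero_le _)]
  have hd2 : ∀ i < n, d i ^ 2 ≤ (a + b) / 2 / n ^ 2 - (u i - u (i + 1)) ^ 2 / 4 := by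
    intro i hi
    have h := hM.coneDistSq_midpoints_le hk hkr hgeo (hP i hi.le) (hQ i hi.le) (hP (i + 1) hi)
      (hQ (i + 1) hi) (hPQ i hi.le) (hPP i hi) (hPQ (i + 1) hi) (hN i hi.le) (hN (i + 1) hi)
    rw [ha i hi, hb i hi] at h
    simp only [hd]
    rw [Real.sq_sqrt (coneDistSq_nonneg (hN i hi.le).nonneg (hN (i + 1) hi).nonneg)]
    refine h.trans (le_of_eq ?_)
    ring
  have hsum : ∀ j ≤ n, √(coneDistSq k (P 0) (N j)) ≤ ∑ i ∈ Finset.range j, d i := by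
    intro j
    induction j with
    | zero =>
      intro _
      have h := (hN 0 (Nat.zero_le _)).coneDistSq_le (P 0) (hP 0 (Nat.zero_le _)).le
        (by rw [dist_self]; positivity)
      rw [← hstart, coneDistSq_self] at h
      rw [Finset.sum_range_zero, Real.sqrt_eq_zero_of_nonpos (by linarith)]
    | succ j ih =>
      intro hj
      rw [Finset.sum_range_succ]
      have hNj := hN j (by omega)
      have hNj' := hN (j + 1) hj
      refine (sqrt_coneDistSq_triangle hk.le (P := P 0) (Q := N j) (W := N (j + 1))
        (hP 0 (Nat.zero_le _)).le hNj'.nonneg ?_).trans (add_le_add (ih (by omega)) le_rfl)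
      have t1 := dist_triangle (P 0).2 (P j).2 (N j).2
      have t2 := dist_triangle_left (N j).2 (N (j + 1)).2 (P j).2
      have t3 := dist_triangle (P j).2 (P (j + 1)).2 (N (j + 1)).2
      have t4 := hPQ j (by omega)
      have t5 := hPQ (j + 1) hj
      have t6 := hPP j (by omega)
      have t7 := hfar j (by omega)
      have t8 := hNj.dist_le
      have t9 := hNj'.dist_le
      have : dist (P 0).2 (N j).2 + dist (N j).2 (N (j + 1)).2 ≤ dist (P 0).2 (P j).2 + r := by
        linarith
      nlinarith
  have hu0 : u 0 = 0 := by
    simp only [hu]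
    rw [← hstart, coneDistSq_self, Real.sqrt_zero]
  have hun : u n ^ 2 = coneDistSq k (P n) (Q n) :=
    Real.sq_sqrt (coneDistSq_nonneg (hP n le_rfl).le (hQ n le_rfl).le)
  have hn0 : (0 : ℝ) < n := by exact_mod_cast hn
  -- The widths `u i` start at `0`, so their increments telescope to the last width.
  have c1 : u n ^ 2 ≤ n * ∑ i ∈ Finset.range n, (u i - u (i + 1)) ^ 2 := by
    have h := sq_sum_le_card_mul_sum_sq (s := Finset.range n) (f := fun i => u i - u (i + 1))
    rw [Finset.sum_range_sub', hu0, Finset.card_range] at h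
    linarith
  have c2 : (∑ i ∈ Finset.range n, d i) ^ 2 ≤ n * ∑ i ∈ Finset.range n, d i ^ 2 := by
    have h := sq_sum_le_card_mul_sum_sq (s := Finset.range n) (f := d)
    rwa [Finset.card_range] at h
  have c3 : ∑ i ∈ Finset.range n, d i ^ 2 ≤
      ∑ i ∈ Finset.range n, ((a + b) / 2 / n ^ 2 - (u i - u (i + 1)) ^ 2 / 4) :=
    Finset.sum_le_sum fun i hi => hd2 i (Finset.mem_range.1 hi)
  rw [Finset.sum_sub_distrib, Finset.sum_const, Finset.card_range, nsmul_eq_mul,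
    ← Finset.sum_div] at c3
  have c4 : coneDistSq k (P 0) (N n) ≤ (∑ i ∈ Finset.range n, d i) ^ 2 := by
    rw [← Real.sq_sqrt (coneDistSq_nonneg (k := k) (hP 0 (Nat.zero_le _)).le (hN n le_rfl).nonneg)]
    exact pow_le_pow_left₀ (Real.sqrt_nonneg _) (hsum n le_rfl) 2
  have c5 := mul_le_mul_of_nonneg_left c3 hn0.le
  have c6 : (n : ℝ) * (n * ((a + b) / 2 / n ^ 2)) = (a + b) / 2 := by field_simp
  rw [mul_sub, c6, ← mul_div_assoc] at c5
  rw [← hun]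
  linarith

end Cone

/-! ### Globalization of the midpoint inequality -/

/-- The angle of the point at fraction `s` of the chord subtending an angle `A`. -/
noncomputable def chordAngle (A s : ℝ) : ℝ :=
  Real.arctan (s * Real.sin A / ((1 - s) + s * Real.cos A))

/-- The radius of the point at fraction `s` of the chord subtending an angle `A`. -/
noncomputable def chordRadius (A s : ℝ) : ℝ :=
  √(((1 - s) + s * Real.cos A) ^ 2 + (s * Real.sin A) ^ 2)

theorem chord_base_pos {A s : ℝ} (hA0 : 0 ≤ A) (hA : A < Real.pi / 2) (hs : s ∈ Set.Icc (0 : ℝ) 1) :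
    0 < (1 - s) + s * Real.cos A := by
  simpa using (arctan_chord_mem one_pos one_pos hA0 hA hs).1

theorem chordAngle_mem {A s : ℝ} (hA0 : 0 ≤ A) (hA : A < Real.pi / 2)
    (hs : s ∈ Set.Icc (0 : ℝ) 1) : chordAngle A s ∈ Set.Icc 0 A := by
  simpa [chordAngle] using (arctan_chord_mem one_pos one_pos hA0 hA hs).2

theorem chordRadius_pos {A s : ℝ} (hA0 : 0 ≤ A) (hA : A < Real.pi / 2)
    (hs : s ∈ Set.Icc (0 : ℝ) 1) : 0 < chordRadius A s := by
  have := chord_base_pos hA0 hA hs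
  unfold chordRadius
  positivity

section Globalize

variable {M : Type*} [MetricSpace M]

/-- The point at fraction `s` of the chord of the cone over the geodesic `γ` of angle `A`. -/
noncomputable def chordPoint (γ : unitInterval → M) (A s : ℝ) : ℝ × M :=
  (chordRadius A s, γ (Set.projIcc 0 1 zero_le_one (chordAngle A s / A)))

theorem chordPoint_zero {γ : unitInterval → M} {z x : M} (hγ : IsConstantSpeedGeodesic dist γ z x)
    (A : ℝ) : chordPoint γ A 0 = (1, z) := by
  simp [chordPoint, chordRadius, chordAngle, hγ.source]

theorem chordPoint_one {γ : unitInterval → M} {z x : M} (hγ : IsConstantSpeedGeodesic dist γ z x)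
    {A : ℝ} (hA0 : 0 < A) (hA : A < Real.pi / 2) : chordPoint γ A 1 = (1, x) := by
  have h1 : chordAngle A 1 = A := by
    unfold chordAngle
    rw [sub_self, zero_add, one_mul, one_mul, ← Real.tan_eq_sin_div_cos,
      Real.arctan_tan (by linarith [Real.pi_pos]) hA]
  have h2 : chordRadius A 1 = 1 := by
    unfold chordRadius
    rw [sub_self, zero_add, one_mul, one_mul, Real.cos_sq_add_sin_sq, Real.sqrt_one]
  unfold chordPoint
  rw [h1, h2, div_self hA0.ne', Set.projIcc_right]
  exact Prod.ext rfl hγ.target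

theorem mul_dist_chordPoint {γ : unitInterval → M} {z x : M}
    (hγ : IsConstantSpeedGeodesic dist γ z x) {k A s s' : ℝ} (hAk : A = k * dist z x)
    (hA0 : 0 < A) (hA : A < Real.pi / 2) (hs : s ∈ Set.Icc (0 : ℝ) 1)
    (hs' : s' ∈ Set.Icc (0 : ℝ) 1) :
    k * dist (chordPoint γ A s).2 (chordPoint γ A s').2 = |chordAngle A s - chordAngle A s'| := by
  have hm : ∀ t ∈ Set.Icc (0 : ℝ) 1, chordAngle A t / A ∈ Set.Icc (0 : ℝ) 1 := fun t ht => by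
    have := chordAngle_mem hA0.le hA ht
    exact ⟨div_nonneg this.1 hA0.le, (div_le_one hA0).2 this.2⟩
  unfold chordPoint
  simp only
  rw [hγ.dist_eq, Set.projIcc_of_mem _ (hm s hs), Set.projIcc_of_mem _ (hm s' hs')]
  simp only
  rw [← sub_div, abs_div, abs_of_pos hA0, mul_left_comm, ← hAk, div_mul_cancel₀ _ hA0.ne']

/-- The cone over a geodesic is a Euclidean sector, in which the chord of angle `A` is a segment of
squared length `2 - 2 * cos A` traversed at constant speed. -/
theorem coneDistSq_chordPoint {γ : unitInterval → M} {z x : M}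
    (hγ : IsConstantSpeedGeodesic dist γ z x) {k A s s' : ℝ} (hAk : A = k * dist z x)
    (hA0 : 0 < A) (hA : A < Real.pi / 2) (hs : s ∈ Set.Icc (0 : ℝ) 1)
    (hs' : s' ∈ Set.Icc (0 : ℝ) 1) :
    coneDistSq k (chordPoint γ A s) (chordPoint γ A s') =
      (2 - 2 * Real.cos A) * (s - s') ^ 2 := by
  unfold coneDistSq
  rw [mul_dist_chordPoint hγ hAk hA0 hA hs hs', Real.cos_abs, Real.cos_sub]
  have c1 := sqrt_mul_cos_arctan (Y := s * Real.sin A) (chord_base_pos hA0.le hA hs)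
  have s1 := sqrt_mul_sin_arctan (Y := s * Real.sin A) (chord_base_pos hA0.le hA hs)
  have c2 := sqrt_mul_cos_arctan (Y := s' * Real.sin A) (chord_base_pos hA0.le hA hs')
  have s2 := sqrt_mul_sin_arctan (Y := s' * Real.sin A) (chord_base_pos hA0.le hA hs')
  have r1 : chordRadius A s ^ 2 = ((1 - s) + s * Real.cos A) ^ 2 + (s * Real.sin A) ^ 2 :=
    Real.sq_sqrt (by positivity)
  have r2 : chordRadius A s' ^ 2 = ((1 - s') + s' * Real.cos A) ^ 2 + (s' * Real.sin A) ^ 2 :=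
    Real.sq_sqrt (by positivity)
  have hsc := Real.sin_sq_add_cos_sq A
  change chordRadius A s * Real.cos (chordAngle A s) = _ at c1
  change chordRadius A s * Real.sin (chordAngle A s) = _ at s1
  change chordRadius A s' * Real.cos (chordAngle A s') = _ at c2
  change chordRadius A s' * Real.sin (chordAngle A s') = _ at s2
  change chordRadius A s ^ 2 + chordRadius A s' ^ 2 - 2 * chordRadius A s * chordRadius A s' * _ = _
  calc _ = chordRadius A s ^ 2 + chordRadius A s' ^ 2 -
        2 * ((chordRadius A s * Real.cos (chordAngle A s)) *
          (chordRadius A s' * Real.cos (chordAngle A s')) +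
        (chordRadius A s * Real.sin (chordAngle A s)) *
          (chordRadius A s' * Real.sin (chordAngle A s'))) := by ring
    _ = _ := by
      rw [c1, s1, c2, s2, r1, r2]
      linear_combination (s - s') ^ 2 * hsc

theorem mul_dist_chordPoint_le {γ : unitInterval → M} {z x : M}
    (hγ : IsConstantSpeedGeodesic dist γ z x) {k A s : ℝ} (hAk : A = k * dist z x)
    (hA0 : 0 < A) (hA : A < Real.pi / 2) (hs : s ∈ Set.Icc (0 : ℝ) 1) :
    k * dist (chordPoint γ A 0).2 (chordPoint γ A s).2 ≤ A := by
  have h0 : (0 : ℝ) ∈ Set.Icc (0 : ℝ) 1 := ⟨le_rfl, zero_le_one⟩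
  rw [mul_dist_chordPoint hγ hAk hA0 hA h0 hs]
  have h1 := chordAngle_mem hA0.le hA h0
  have h2 := chordAngle_mem hA0.le hA hs
  exact abs_sub_le_of_nonneg_of_le h1.1 h1.2 h2.1 h2.2

/-- In a compact space, geodesics from `z` depend continuously on their endpoint, at a point
that is joined to `z` by only one geodesic. -/
theorem eventually_dist_geodesic_lt [CompactSpace M] {z y : M} {γ₀ : unitInterval → M}
    (huniq : ∀ γ, IsConstantSpeedGeodesic dist γ z y → γ = γ₀) (s : unitInterval) {η : ℝ}
    (hη : 0 < η) : ∀ᶠ x in 𝓝 y, ∀ γ : unitInterval → M, IsConstantSpeedGeodesic dist γ z x →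
      dist (γ s) (γ₀ s) < η := by
  -- The set of geodesics from `z` that violate the bound, paired with their endpoints, is closed
  -- for pointwise convergence. By Tychonoff its projection to `M` is closed, and uniqueness keeps
  -- `y` out of it.
  let K : Set ((unitInterval → M) × M) :=
    {w | w.1 0 = z} ∩ {w | w.1 1 = w.2} ∩
      (⋂ (a : unitInterval) (b : unitInterval),
        {w | dist (w.1 a) (w.1 b) = |(a : ℝ) - b| * dist z w.2}) ∩
      {w | η ≤ dist (w.1 s) (γ₀ s)}
  have hK : IsClosed K := by
    refine ((IsClosed.inter ?_ ?_).inter (isClosed_iInter fun a => isClosed_iInter fun b => ?_)).inter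
      ?_
    · exact isClosed_eq (by fun_prop) continuous_const
    · exact isClosed_eq (by fun_prop) continuous_snd
    · exact isClosed_eq (by fun_prop) (by fun_prop)
    · exact isClosed_le continuous_const (by fun_prop)
  have himg : IsClosed (Prod.snd '' K) := isClosedMap_snd_of_compactSpace K hK
  have hy : y ∉ Prod.snd '' K := by
    rintro ⟨⟨γ, y'⟩, ⟨⟨⟨h0, h1⟩, h2⟩, h3⟩, rfl⟩
    have hγ : IsConstantSpeedGeodesic dist γ z y' :=
      ⟨h0, h1, fun a b => Set.mem_iInter.1 (Set.mem_iInter.1 h2 a) b⟩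
    rw [huniq γ hγ] at h3
    simp only [Set.mem_ofPred_eq, dist_self] at h3
    linarith
  filter_upwards [himg.isOpen_compl.mem_nhds hy] with x hx γ hγ
  by_contra hcon
  push Not at hcon
  exact hx ⟨(γ, x), ⟨⟨⟨hγ.source, hγ.target⟩, Set.mem_iInter.2 fun a => Set.mem_iInter.2 fun b =>
    hγ.dist_eq a b⟩, hcon⟩, rfl⟩

/-- Both the geodesic and the parameter on it move with `x`; the second motion is controlled by the
bounded speed of the geodesics. -/
theorem eventually_dist_chordPoint_lt [CompactSpace M] {z y : M} {γ₀ : unitInterval → M}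
    (huniq : ∀ γ, IsConstantSpeedGeodesic dist γ z y → γ = γ₀) {k : ℝ}
    (hA0 : 0 < k * dist z y) (hA : k * dist z y < Real.pi / 2) {s : ℝ}
    (hs : s ∈ Set.Icc (0 : ℝ) 1) {η : ℝ} (hη : 0 < η) :
    ∀ᶠ x in 𝓝 y, ∀ γ : unitInterval → M, IsConstantSpeedGeodesic dist γ z x →
      dist (chordPoint γ (k * dist z x) s).2 (chordPoint γ₀ (k * dist z y) s).2 < η := by
  set τ : M → unitInterval := fun x =>
    Set.projIcc 0 1 zero_le_one (chordAngle (k * dist z x) s / (k * dist z x)) with hτ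
  have hbase := chord_base_pos hA0.le hA hs
  have hcont : ContinuousAt τ y := by
    refine continuous_projIcc.continuousAt.comp (ContinuousAt.div ?_ (by fun_prop) hA0.ne')
    refine Real.continuous_arctan.continuousAt.comp (ContinuousAt.div (by fun_prop) (by fun_prop) ?_)
    exact hbase.ne'
  set B := dist z y + 1 with hB
  have hB0 : 0 < B := by positivity
  have e1 : ∀ᶠ x in 𝓝 y, dist (τ x) (τ y) < η / 2 / B :=
    Metric.tendsto_nhds.1 hcont _ (by positivity)
  have e2 : ∀ᶠ x in 𝓝 y, dist z x < B :=
    (continuous_const.dist continuous_id).continuousAt.eventually_lt continuousAt_const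
      (by simp [hB])
  filter_upwards [e1, e2, eventually_dist_geodesic_lt huniq (τ y) (half_pos hη)] with x h1 h2 h3 γ hγ
  change dist (γ (τ x)) (γ₀ (τ y)) < η
  have h4 : dist (γ (τ x)) (γ (τ y)) ≤ η / 2 := by
    rw [hγ.dist_eq]
    rw [Subtype.dist_eq, Real.dist_eq] at h1
    calc |(τ x : ℝ) - τ y| * dist z x ≤ (η / 2 / B) * B :=
          mul_le_mul h1.le h2.le dist_nonneg (by positivity)
      _ = η / 2 := by field_simp
  have := dist_triangle (γ (τ x)) (γ (τ y)) (γ₀ (τ y))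
  linarith [h3 γ hγ]

theorem exists_subdivision_chordPoint {z y : M} {γ₀ : unitInterval → M} {k : ℝ}
    (hγ₀ : IsConstantSpeedGeodesic dist γ₀ z y)
    (hA0 : 0 < k * dist z y) (hA : k * dist z y < Real.pi / 2) {η : ℝ} (hη : 0 < η) :
    ∃ n : ℕ, 0 < n ∧ ∀ i < n, dist (chordPoint γ₀ (k * dist z y) ((i : ℝ) / n)).2
      (chordPoint γ₀ (k * dist z y) (((i + 1 : ℕ) : ℝ) / n)).2 < η := by
  have hc : ContinuousOn (fun s => (chordPoint γ₀ (k * dist z y) s).2) (Set.Icc 0 1) := by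
    refine (hγ₀.lipschitzWith.continuous.comp continuous_projIcc).comp_continuousOn ?_
    refine ContinuousOn.div_const ?_ _
    refine Real.continuous_arctan.comp_continuousOn (ContinuousOn.div (by fun_prop) (by fun_prop) ?_)
    exact fun s hs => (chord_base_pos hA0.le hA hs).ne'
  obtain ⟨δ, hδ, H⟩ := Metric.uniformContinuousOn_iff.1
    (isCompact_Icc.uniformContinuousOn_of_continuous hc) η hη
  obtain ⟨n, hn⟩ := exists_nat_gt (1 / δ)
  have hn0 : (0 : ℝ) < n := lt_trans (by positivity) hn
  refine ⟨n, by exact_mod_cast hn0, fun i hi => H _ ?_ _ ?_ ?_⟩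
  · exact ⟨by positivity, (div_le_one hn0).2 (by exact_mod_cast hi.le)⟩
  · exact ⟨by positivity, (div_le_one hn0).2 (by exact_mod_cast hi)⟩
  · rw [Real.dist_eq, ← sub_div, abs_div, abs_of_pos hn0]
    push_cast
    rw [sub_add_cancel_left, abs_neg, abs_one]
    rwa [div_lt_iff₀ hn0, mul_comm, ← div_lt_iff₀ hδ]

/-- The midpoint inequality holds for thin triangles with vertex `z`, near a point that is joined
to `z` by a unique geodesic. -/
theorem HasLocalMidpointInequality.eventually_midpointInequality [CompactSpace M] {k r : ℝ}
    (hk : 0 < k) (hr : 0 < r) (hkr : k * r ≤ 1 / 2) (hM : HasLocalMidpointInequality M k r)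
    (hgeo : ∀ x y : M, ∃ γ : unitInterval → M, IsConstantSpeedGeodesic dist γ x y)
    {z y₀ : M} (huniq : ∃! γ : unitInterval → M, IsConstantSpeedGeodesic dist γ z y₀)
    (hA : k * dist z y₀ < Real.pi / 2) :
    ∃ ε > 0, ∀ x y m, dist x y₀ < ε → dist y y₀ < ε → IsMidpoint x y m →
      MidpointInequality k z x y m := by
  have hpi := Real.pi_gt_three
  have hpi4 := Real.pi_lt_four
  rcases lt_or_ge (dist z y₀) (r / 2) with hnear | hfar
  · refine ⟨r / 4, by positivity, fun x y m hx hy hm => hM x y z m ?_ ?_ hm⟩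
    · linarith [dist_triangle_right x y y₀]
    · rw [dist_comm]
      linarith [dist_triangle_right z x y₀]
  obtain ⟨γ₀, hγ₀, hu⟩ := huniq
  have hA0 : 0 < k * dist z y₀ := mul_pos hk (by linarith)
  -- Errors of `r / 64` to and along the reference chord leave all sides of the small quadrilaterals
  -- below `r / 8`.
  obtain ⟨n, hn, hsub⟩ := exists_subdivision_chordPoint hγ₀ hA0 hA
    (show 0 < r / 64 by positivity)
  have hn0 : (0 : ℝ) < n := by exact_mod_cast hn
  have hmem : ∀ i ≤ n, (i : ℝ) / n ∈ Set.Icc (0 : ℝ) 1 := fun i hi =>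
    ⟨by positivity, (div_le_one hn0).2 (by exact_mod_cast hi)⟩
  have e1 : ∀ᶠ x in 𝓝 y₀, ∀ i ∈ Finset.range (n + 1), ∀ γ : unitInterval → M,
      IsConstantSpeedGeodesic dist γ z x →
      dist (chordPoint γ (k * dist z x) ((i : ℝ) / n)).2
        (chordPoint γ₀ (k * dist z y₀) ((i : ℝ) / n)).2 < r / 64 :=
    (Filter.eventually_all_finset _).2 fun i hi =>
      eventually_dist_chordPoint_lt hu hA0 hA (hmem i (by simpa [Nat.lt_succ_iff] using hi))
        (by positivity)
  have hcd : ContinuousAt (fun x => k * dist z x) y₀ := by fun_prop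
  have e2 : ∀ᶠ x in 𝓝 y₀, 0 < k * dist z x := continuousAt_const.eventually_lt hcd hA0
  have e3 : ∀ᶠ x in 𝓝 y₀, k * dist z x < Real.pi / 2 :=
    hcd.eventually_lt continuousAt_const hA
  obtain ⟨ε, hε, H⟩ := Metric.eventually_nhds_iff.1 (e1.and (e2.and e3))
  refine ⟨ε, hε, fun x y m hx hy hm => ?_⟩
  obtain ⟨x1, x2, x3⟩ := H hx
  obtain ⟨y1, y2, y3⟩ := H hy
  obtain ⟨γ, hγ⟩ := hgeo z x
  obtain ⟨γ', hγ'⟩ := hgeo z y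
  set A := k * dist z x with hAdef
  set B := k * dist z y with hBdef
  set P : ℕ → ℝ × M := fun i => chordPoint γ A ((i : ℝ) / n) with hP
  set Q : ℕ → ℝ × M := fun i => chordPoint γ' B ((i : ℝ) / n) with hQ
  set G : ℕ → ℝ × M := fun i => chordPoint γ₀ (k * dist z y₀) ((i : ℝ) / n) with hG
  have dP : ∀ i ≤ n, dist (P i).2 (G i).2 < r / 64 := fun i hi =>
    x1 i (by simpa [Nat.lt_succ_iff] using hi) γ hγ
  have dQ : ∀ i ≤ n, dist (Q i).2 (G i).2 < r / 64 := fun i hi =>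
    y1 i (by simpa [Nat.lt_succ_iff] using hi) γ' hγ'
  have dG : ∀ i < n, dist (G i).2 (G (i + 1)).2 < r / 64 := hsub
  have dPQ : ∀ i ≤ n, dist (P i).2 (Q i).2 < r / 8 := fun i hi => by
    linarith [dist_triangle_right (P i).2 (Q i).2 (G i).2, dP i hi, dQ i hi]
  have hPn : P n = (1, x) := by
    simp only [hP]
    rw [div_self hn0.ne', chordPoint_one hγ x2 x3]
  have hQn : Q n = (1, y) := by
    simp only [hQ]
    rw [div_self hn0.ne', chordPoint_one hγ' y2 y3]
  have hP0 : P 0 = (1, z) := by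
    simp only [hP, Nat.cast_zero, zero_div]
    exact chordPoint_zero hγ A
  have hQ0 : Q 0 = (1, z) := by
    simp only [hQ, Nat.cast_zero, zero_div]
    exact chordPoint_zero hγ' B
  have rP : ∀ i ≤ n, 0 < (P i).1 := fun i hi => chordRadius_pos x2.le x3 (hmem i hi)
  have rQ : ∀ i ≤ n, 0 < (Q i).1 := fun i hi => chordRadius_pos y2.le y3 (hmem i hi)
  have hxy : dist x y < r / 2 := by
    have := dPQ n le_rfl
    rw [hPn, hQn] at this
    simp only at this
    linarith
  -- Intermediate midpoints are arbitrary, but the last one must lie over the given `m`.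
  have hex : ∀ i, ∃ N : ℝ × M, (i ≤ n → IsConeMidpoint k r (P i) (Q i) N) ∧
      (i = n → N = (Real.cos (k * dist x y / 2), m)) := by
    intro i
    by_cases hi : i = n
    · refine ⟨_, fun _ => ?_, fun _ => rfl⟩
      rw [hi, hPn, hQn]
      exact hM.isConeMidpoint hk hkr hxy hm
    · by_cases hin : i ≤ n
      · obtain ⟨N, hN⟩ := hM.exists_isConeMidpoint hk hkr hgeo (rP i hin) (rQ i hin)
          ((dPQ i hin).trans (by linarith))
        exact ⟨N, fun _ => hN, fun h => absurd h hi⟩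
      · exact ⟨(1, z), fun h => absurd h hin, fun h => absurd h hi⟩
  choose N hN hNn using hex
  have hdiff : ∀ i : ℕ, ((i : ℝ) / n - ((i + 1 : ℕ) : ℝ) / n) ^ 2 = 1 / n ^ 2 := fun i => by
    push_cast
    field_simp
    ring
  have key := hM.coneDistSq_chain_le hk hkr hgeo (P := P) (Q := Q) (N := N)
    (a := 2 - 2 * Real.cos A) (b := 2 - 2 * Real.cos B) rP rQ dPQ
    (fun i hi => by
      have t1 := dist_triangle (P i).2 (G i).2 (P (i + 1)).2
      have t2 := dist_triangle_right (G i).2 (P (i + 1)).2 (G (i + 1)).2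
      linarith [dP i hi.le, dP (i + 1) hi, dG i hi])
    (fun i hi => by
      have := mul_dist_chordPoint_le hγ hAdef x2 x3 (hmem i hi)
      simp only [hP, Nat.cast_zero, zero_div]
      linarith)
    (by rw [hP0, hQ0])
    (fun i hi => by
      simp only [hP]
      rw [coneDistSq_chordPoint hγ hAdef x2 x3 (hmem i hi.le) (hmem (i + 1) hi), hdiff]
      ring)
    (fun i hi => by
      simp only [hQ]
      rw [coneDistSq_chordPoint hγ' hBdef y2 y3 (hmem i hi.le) (hmem (i + 1) hi), hdiff]
      ring)
    (fun i hi => hN i hi) hn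
  rw [hP0, hPn, hQn, hNn n rfl] at key
  unfold coneDistSq at key
  simp only at key
  have hc : Real.cos (k * dist x y) = 2 * Real.cos (k * dist x y / 2) ^ 2 - 1 := by
    rw [← Real.cos_two_mul]
    ring_nf
  rw [hc] at key
  unfold MidpointInequality
  linear_combination key

/-- Triangles in convex balls satisfy the comparison inequality with the sphere of
curvature `k ^ 2`. -/
theorem HasLocalMidpointInequality.sin_interpolation_le_of_convex [CompactSpace M] {k r : ℝ}
    (hk : 0 < k) (hr : 0 < r) (hkr : k * r ≤ 1 / 2) (hM : HasLocalMidpointInequality M k r)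
    (hgeo : ∀ x y : M, ∃ γ : unitInterval → M, IsConstantSpeedGeodesic dist γ x y)
    {z : M} {s : ℝ} (hs0 : 0 < s) (hball : IsGeodesicallyConvex (Metric.ball z s)) {p q : M}
    (hp : dist z p < s) (hq : dist z q < s) (hks : ∀ w, dist z w < s → k * dist z w < Real.pi / 2)
    {γ : unitInterval → M} (hγ : IsConstantSpeedGeodesic dist γ p q) (t : unitInterval) :
    Real.sin ((1 - t) * (k * dist p q)) * Real.cos (k * dist z p) +
        Real.sin (t * (k * dist p q)) * Real.cos (k * dist z q) ≤
      Real.sin (k * dist p q) * Real.cos (k * dist z (γ t)) := by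
  refine hγ.sin_interpolation_le hk ?_ (fun u => ?_) t
  · have := dist_triangle_left p q z
    have := hks p hp
    have := hks q hq
    nlinarith
  -- Convexity is used twice: the side stays in the ball, and each of its points has a unique
  -- geodesic to `z`.
  · have hmem := (hball p (Metric.mem_ball'.2 hp) q (Metric.mem_ball'.2 hq)).2 γ hγ u
    obtain ⟨ε, hε, H⟩ := hM.eventually_midpointInequality hk hr hkr hgeo
      (hball z (Metric.mem_ball_self hs0) (γ u) hmem).1 (hks _ (Metric.mem_ball'.1 hmem))
    exact ⟨ε, hε, fun p' q' h1 h2 h3 => H p' q' _ h1 h2 h3⟩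

end Globalize

/-! ### Chebyshev centers -/

theorem le_three_quarters_of_cos_le_sq {D R : ℝ} (hD : D ≤ Real.pi / 4) (hRD : R ≤ D)
    (h : Real.cos D ≤ Real.cos R ^ 2) : R ≤ 3 / 4 * D := by
  by_contra hcon
  push Not at hcon
  have hpi := Real.pi_pos
  have h1 : Real.cos R < Real.cos (3 / 4 * D) :=
    Real.cos_lt_cos_of_nonneg_of_le_pi (by linarith) (by linarith) hcon
  have h2 : 0 ≤ Real.cos R := Real.cos_nonneg_of_mem_Icc ⟨by linarith, by linarith⟩
  have h3 : Real.cos R ^ 2 < Real.cos (3 / 4 * D) ^ 2 := pow_lt_pow_left₀ h1 h2 two_ne_zero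
  have h4 : Real.cos (3 / 4 * D) ^ 2 = (1 + Real.cos (3 * (D / 2))) / 2 := by
    rw [Real.cos_sq]
    ring_nf
  have h5 : Real.cos D = 2 * Real.cos (D / 2) ^ 2 - 1 := by
    rw [← Real.cos_two_mul]
    ring_nf
  rw [Real.cos_three_mul] at h4
  have h6 : √3 / 2 ≤ Real.cos (D / 2) := by
    rw [← Real.cos_pi_div_six]
    exact Real.cos_le_cos_of_nonneg_of_le_pi (by linarith) (by linarith) (by linarith)
  have h7 : 3 / 4 ≤ Real.cos (D / 2) ^ 2 := by
    have := pow_le_pow_left₀ (by positivity) h6 2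
    rw [div_pow, Real.sq_sqrt (by norm_num)] at this
    linarith
  have h8 := Real.cos_le_one (D / 2)
  -- With `x = cos (D / 2)` the remaining claim is `(x - 1) * (4 * x ^ 2 - 3) ≤ 0`.
  nlinarith [mul_nonneg (sub_nonneg.2 h8) (sub_nonneg.2 h7)]

/-- The first variation at `t = 0`: the product formulas allow division by `2 * sin (t * l / 2)`
before the limit. -/
theorem le_mul_cos_of_sin_interpolation {a b l : ℝ} (hl0 : 0 < l) (hl : l < Real.pi)
    (h : ∀ t ∈ Set.Ioo (0 : ℝ) 1,
      Real.sin ((1 - t) * l) * a + Real.sin (t * l) * b ≤ Real.sin l * a) :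
    b ≤ a * Real.cos l := by
  have key : ∀ t ∈ Set.Ioo (0 : ℝ) 1,
      b * Real.cos (t * l / 2) ≤ a * Real.cos (l - t * l / 2) := by
    intro t ht
    have hs : 0 < Real.sin (t * l / 2) :=
      Real.sin_pos_of_pos_of_lt_pi (by nlinarith [mul_pos ht.1 hl0]) (by nlinarith [ht.2])
    have h1 : Real.sin (t * l) = 2 * Real.sin (t * l / 2) * Real.cos (t * l / 2) := by
      rw [← Real.sin_two_mul]
      ring_nf
    have h2 : Real.sin l - Real.sin ((1 - t) * l) =
        2 * Real.sin (t * l / 2) * Real.cos (l - t * l / 2) := by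
      rw [Real.sin_sub_sin]
      ring_nf
    have h3 := h t ht
    refine le_of_mul_le_mul_left ?_ (show 0 < 2 * Real.sin (t * l / 2) by positivity)
    linear_combination h3 - b * h1 + a * h2
  have h1 : Filter.Tendsto (fun t : ℝ => b * Real.cos (t * l / 2)) (𝓝[>] 0)
      (𝓝 (b * Real.cos (0 * l / 2))) :=
    ((by fun_prop : Continuous fun t : ℝ => b * Real.cos (t * l / 2)).tendsto 0).mono_left
      nhdsWithin_le_nhds
  have h2 : Filter.Tendsto (fun t : ℝ => a * Real.cos (l - t * l / 2)) (𝓝[>] 0)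
      (𝓝 (a * Real.cos (l - 0 * l / 2))) :=
    ((by fun_prop : Continuous fun t : ℝ => a * Real.cos (l - t * l / 2)).tendsto 0).mono_left
      nhdsWithin_le_nhds
  have h3 := le_of_tendsto_of_tendsto h1 h2
    (by filter_upwards [Ioo_mem_nhdsGT (zero_lt_one' ℝ)] with t ht using key t ht)
  simpa using h3

section Chebyshev

variable {M : Type*} [MetricSpace M]

theorem exists_isChebyshevCenter [CompactSpace M] {A : Set M} (hA : A.Finite) (hne : A.Nonempty) :
    ∃ c, IsChebyshevCenter A c := by
  have hne' : hA.toFinset.Nonempty := by simpa using hne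
  obtain ⟨a, ha⟩ := hne
  have hcont : Continuous fun c : M => hA.toFinset.sup' hne' fun a => dist a c :=
    Continuous.finset_sup'_apply hne' fun a _ => by fun_prop
  obtain ⟨c, -, hc⟩ := isCompact_univ.exists_isMinOn ⟨a, Set.mem_univ a⟩ hcont.continuousOn
  refine ⟨c, hA.toFinset.sup' hne' fun a => dist a c, fun b hb => Metric.mem_closedBall.2
    (Finset.le_sup' (fun a => dist a c) (hA.mem_toFinset.2 hb)), fun c' r' h => ?_⟩
  exact (hc (Set.mem_univ c')).trans
    (Finset.sup'_le _ _ fun b hb => Metric.mem_closedBall.1 (h (hA.mem_toFinset.1 hb)))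

/-- `c` is a Chebyshev center of `A`, with circumradius `r`. -/
structure IsCircumcenter (A : Set M) (c : M) (r : ℝ) : Prop where
  dist_le : ∀ a ∈ A, dist a c ≤ r
  le_of_dist_le : ∀ (c' : M) (r' : ℝ), (∀ a ∈ A, dist a c' ≤ r') → r ≤ r'

theorem IsChebyshevCenter.exists_isCircumcenter {A : Set M} {c : M} (h : IsChebyshevCenter A c) :
    ∃ r, IsCircumcenter A c r := by
  obtain ⟨r, h1, h2⟩ := h
  exact ⟨r, fun a ha => Metric.mem_closedBall.1 (h1 ha), fun c' r' h' => h2 c' r' h'⟩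

theorem IsCircumcenter.exists_le_dist {A : Set M} {c : M} {r : ℝ} (h : IsCircumcenter A c r)
    (hA : A.Finite) (hne : A.Nonempty) (p : M) : ∃ a ∈ A, r ≤ dist a p := by
  obtain ⟨a, ha, hmax⟩ := hA.exists_maximalFor (fun a => dist a p) A hne
  refine ⟨a, ha, h.le_of_dist_le p _ fun b hb => ?_⟩
  by_contra hlt
  push Not at hlt
  exact hlt.not_ge (hmax hb hlt.le)

/-- Triangles with a vertex in `A` and two vertices at distance at most `D` from it satisfy the
comparison inequality with the sphere of curvature `k ^ 2`. -/
def HasSphericalComparison (k : ℝ) (A : Set M) (D : ℝ) : Prop :=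
  ∀ z ∈ A, ∀ p q, dist z p ≤ D → dist z q ≤ D → ∀ γ : unitInterval → M,
    IsConstantSpeedGeodesic dist γ p q → ∀ t : unitInterval,
    Real.sin ((1 - t) * (k * dist p q)) * Real.cos (k * dist z p) +
        Real.sin (t * (k * dist p q)) * Real.cos (k * dist z q) ≤
      Real.sin (k * dist p q) * Real.cos (k * dist z (γ t))

theorem HasSphericalComparison.mono {k D : ℝ} {A B : Set M} (h : HasSphericalComparison k B D)
    (hAB : A ⊆ B) : HasSphericalComparison k A D :=
  fun z hz => h z (hAB hz)

/-- By minimality of `r`, at each time some `y` in `A` has distance at least `r` from the moving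
point, though at most `r` from `c`. This `y` depends on the time, but the inequality obtained from
it does not, so the limit can be taken. -/
theorem IsCircumcenter.le_cos_mul_cos {k D r b : ℝ} {A : Set M} {c q : M} (hk : 0 < k)
    (hc : IsCircumcenter A c r) (hA : A.Finite) (hne : A.Nonempty)
    (hcmp : HasSphericalComparison k A D) (hkD : k * D ≤ Real.pi / 4) (hr0 : 0 ≤ r) (hrD : r ≤ D)
    (hgeo : ∃ γ : unitInterval → M, IsConstantSpeedGeodesic dist γ c q)
    (hq : ∀ y ∈ A, dist y q ≤ D) (hb : ∀ y ∈ A, b ≤ Real.cos (k * dist y q)) :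
    b ≤ Real.cos (k * r) * Real.cos (k * dist c q) := by
  obtain ⟨γ, hγ⟩ := hgeo
  have hpi := Real.pi_pos
  have hkr : k * r ≤ Real.pi / 4 := (mul_le_mul_of_nonneg_left hrD hk.le).trans hkD
  obtain ⟨y₀, hy₀, hr₀⟩ := hc.exists_le_dist hA hne c
  have hl : k * dist c q ≤ Real.pi / 2 := by
    have h1 := dist_triangle_left c q y₀
    have h2 := hc.dist_le y₀ hy₀
    have h3 := hq y₀ hy₀
    nlinarith
  rcases (dist_nonneg (x := c) (y := q)).eq_or_lt with h0 | hpos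
  · rw [← h0, mul_zero, Real.cos_zero, mul_one]
    have hcq := dist_eq_zero.1 h0.symm
    have := hb y₀ hy₀
    rwa [← hcq, le_antisymm (hc.dist_le y₀ hy₀) hr₀] at this
  refine le_mul_cos_of_sin_interpolation (by positivity) (by linarith) fun t ht => ?_
  obtain ⟨y, hy, hry⟩ := hc.exists_le_dist hA hne (γ ⟨t, ht.1.le, ht.2.le⟩)
  have h := hcmp y hy c q ((hc.dist_le y hy).trans hrD) (hq y hy) γ hγ ⟨t, ht.1.le, ht.2.le⟩
  simp only at h
  set l := k * dist c q with hldef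
  have hl0 : 0 < l := by positivity
  have s1 : 0 ≤ Real.sin ((1 - t) * l) :=
    Real.sin_nonneg_of_nonneg_of_le_pi (mul_nonneg (by linarith [ht.2]) hl0.le)
      (by nlinarith [ht.1])
  have s2 : 0 ≤ Real.sin (t * l) :=
    Real.sin_nonneg_of_nonneg_of_le_pi (mul_nonneg ht.1.le hl0.le) (by nlinarith [ht.2])
  have s3 : 0 ≤ Real.sin l := Real.sin_nonneg_of_nonneg_of_le_pi hl0.le (by linarith)
  have c1 : Real.cos (k * r) ≤ Real.cos (k * dist y c) :=
    Real.cos_le_cos_of_nonneg_of_le_pi (by positivity) (by linarith)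
      (mul_le_mul_of_nonneg_left (hc.dist_le y hy) hk.le)
  have c2 : Real.cos (k * dist y (γ ⟨t, ht.1.le, ht.2.le⟩)) ≤ Real.cos (k * r) := by
    refine Real.cos_le_cos_of_nonneg_of_le_pi (by positivity) ?_
      (mul_le_mul_of_nonneg_left hry hk.le)
    have h1 := dist_triangle y c (γ ⟨t, ht.1.le, ht.2.le⟩)
    rw [hγ.dist_source] at h1
    have h2 : t * dist c q ≤ dist c q := mul_le_of_le_one_left dist_nonneg ht.2.le
    have h3 : dist y (γ ⟨t, ht.1.le, ht.2.le⟩) ≤ r + dist c q := by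
      have := hc.dist_le y hy
      simp only at h1
      linarith
    nlinarith
  have m1 := mul_le_mul_of_nonneg_left c1 s1
  have m2 := mul_le_mul_of_nonneg_left (hb y hy) s2
  have m3 := mul_le_mul_of_nonneg_left c2 s3
  linarith

/-- A finite set of diameter at most `D`, in a region where triangles satisfy the comparison
inequality with the sphere of curvature `k ^ 2`. -/
structure IsComparisonSet (k D : ℝ) (A : Set M) : Prop where
  finite : A.Finite
  nonempty : A.Nonempty
  dist_le : ∀ x ∈ A, ∀ y ∈ A, dist x y ≤ D
  scale_le : k * D ≤ Real.pi / 4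
  comparison : HasSphericalComparison k A D

theorem IsComparisonSet.mono {k D : ℝ} {A B : Set M} (hB : IsComparisonSet k D B) (hAB : A ⊆ B)
    (hA : A.Nonempty) : IsComparisonSet k D A :=
  ⟨hB.finite.subset hAB, hA, fun x hx y hy => hB.dist_le x (hAB hx) y (hAB hy), hB.scale_le,
    hB.comparison.mono hAB⟩

theorem IsComparisonSet.radius_mem {k D r : ℝ} {A : Set M} {c : M} (hA : IsComparisonSet k D A)
    (hc : IsCircumcenter A c r) : r ∈ Set.Icc 0 D := by
  obtain ⟨a, ha⟩ := hA.nonempty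
  exact ⟨dist_nonneg.trans (hc.dist_le a ha), hc.le_of_dist_le a D fun b hb => hA.dist_le b hb a ha⟩

/-- Jung's inequality for the circumradius. -/
theorem IsComparisonSet.radius_le {k D r : ℝ} {A : Set M} {c : M} (hk : 0 < k)
    (hgeo : ∀ x y : M, ∃ γ : unitInterval → M, IsConstantSpeedGeodesic dist γ x y)
    (hA : IsComparisonSet k D A) (hc : IsCircumcenter A c r) : r ≤ 3 / 4 * D := by
  obtain ⟨hr0, hrD⟩ := hA.radius_mem hc
  have hpi := Real.pi_pos
  obtain ⟨x, hx, hrx⟩ := hc.exists_le_dist hA.finite hA.nonempty c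
  have hdx : dist c x = r := by
    rw [dist_comm]
    exact le_antisymm (hc.dist_le x hx) hrx
  -- The target is a point of `A` on the boundary of the minimal ball, which gives `cos (k * D) ≤
  -- cos (k * r) ^ 2`.
  have h := hc.le_cos_mul_cos (q := x) (b := Real.cos (k * D)) hk hA.finite hA.nonempty
    hA.comparison hA.scale_le hr0 hrD (hgeo c x) (fun y hy => hA.dist_le y hy x hx)
    (fun y hy => Real.cos_le_cos_of_nonneg_of_le_pi (by positivity) (by linarith [hA.scale_le])
      (mul_le_mul_of_nonneg_left (hA.dist_le y hy x hx) hk.le))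
  rw [hdx, ← sq] at h
  have := le_three_quarters_of_cos_le_sq hA.scale_le
    (mul_le_mul_of_nonneg_left hrD hk.le) h
  refine le_of_mul_le_mul_left ?_ hk
  linarith

/-- A spherical Pythagorean inequality for the two centers. Dropping `cos (k * r)` bounds their
distance, and `A = B` makes them equal. -/
theorem IsComparisonSet.cos_radius_le {k D r r' : ℝ} {A B : Set M} {c c' : M} (hk : 0 < k)
    (hgeo : ∀ x y : M, ∃ γ : unitInterval → M, IsConstantSpeedGeodesic dist γ x y)
    (hB : IsComparisonSet k D B) (hAB : A ⊆ B) (hA : A.Nonempty) (hc : IsCircumcenter A c r)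
    (hc' : IsCircumcenter B c' r') :
    Real.cos (k * r') ≤ Real.cos (k * r) * Real.cos (k * dist c c') := by
  have hA' := hB.mono hAB hA
  obtain ⟨hr0, hrD⟩ := hA'.radius_mem hc
  obtain ⟨hr0', hrD'⟩ := hB.radius_mem hc'
  have hpi := Real.pi_pos
  refine hc.le_cos_mul_cos hk hA'.finite hA hA'.comparison hA'.scale_le hr0 hrD (hgeo c c')
    (fun y hy => (hc'.dist_le y (hAB hy)).trans hrD') fun y hy => ?_
  refine Real.cos_le_cos_of_nonneg_of_le_pi (by positivity) ?_
    (mul_le_mul_of_nonneg_left (hc'.dist_le y (hAB hy)) hk.le)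
  have := mul_le_mul_of_nonneg_left hrD' hk.le
  linarith [hB.scale_le]

theorem IsComparisonSet.dist_circumcenter_le {k D r r' : ℝ} {A B : Set M} {c c' : M} (hk : 0 < k)
    (hgeo : ∀ x y : M, ∃ γ : unitInterval → M, IsConstantSpeedGeodesic dist γ x y)
    (hB : IsComparisonSet k D B) (hAB : A ⊆ B) (hA : A.Nonempty) (hc : IsCircumcenter A c r)
    (hc' : IsCircumcenter B c' r') : dist c c' ≤ r' := by
  have h := hB.cos_radius_le hk hgeo hAB hA hc hc'
  obtain ⟨hr0, hrD⟩ := (hB.mono hAB hA).radius_mem hc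
  obtain ⟨hr0', hrD'⟩ := hB.radius_mem hc'
  have hpi := Real.pi_pos
  have h1 := mul_le_mul_of_nonneg_left hrD hk.le
  have h1' := mul_le_mul_of_nonneg_left hrD' hk.le
  have hsc := hB.scale_le
  by_contra hcon
  push Not at hcon
  have hd : dist c c' ≤ 2 * D := by
    obtain ⟨a, ha⟩ := hA
    have := dist_triangle_left c c' a
    linarith [hc.dist_le a ha, hc'.dist_le a (hAB ha)]
  have h2 : Real.cos (k * dist c c') < Real.cos (k * r') :=
    Real.cos_lt_cos_of_nonneg_of_le_pi (by positivity) (by nlinarith)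
      (mul_lt_mul_of_pos_left hcon hk)
  have h3 : 0 < Real.cos (k * r') :=
    Real.cos_pos_of_mem_Ioo ⟨by linarith [mul_nonneg hk.le hr0'], by linarith⟩
  have h4 : 0 < Real.cos (k * r) :=
    Real.cos_pos_of_mem_Ioo ⟨by linarith [mul_nonneg hk.le hr0], by linarith⟩
  have h5 := Real.cos_le_one (k * r)
  nlinarith

theorem IsComparisonSet.existsUnique_isChebyshevCenter [CompactSpace M] {k D : ℝ} {A : Set M}
    (hk : 0 < k) (hgeo : ∀ x y : M, ∃ γ : unitInterval → M, IsConstantSpeedGeodesic dist γ x y)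
    (hA : IsComparisonSet k D A) : ∃! c, IsChebyshevCenter A c := by
  obtain ⟨c, hc⟩ := exists_isChebyshevCenter hA.finite hA.nonempty
  refine ⟨c, hc, fun c' hc' => ?_⟩
  obtain ⟨r, hr⟩ := hc.exists_isCircumcenter
  obtain ⟨r', hr'⟩ := hc'.exists_isCircumcenter
  have hrr : r = r' :=
    le_antisymm (hr.le_of_dist_le c' r' hr'.dist_le) (hr'.le_of_dist_le c r hr.dist_le)
  have hpi := Real.pi_pos
  have h := hA.cos_radius_le hk hgeo subset_rfl hA.nonempty hr' hr
  rw [hrr] at h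
  obtain ⟨hr0, hrD⟩ := hA.radius_mem hr'
  have h1 := mul_le_mul_of_nonneg_left hrD hk.le
  have hsc := hA.scale_le
  have h3 : 0 < Real.cos (k * r') :=
    Real.cos_pos_of_mem_Ioo ⟨by linarith [mul_nonneg hk.le hr0], by linarith⟩
  have h4 : 1 ≤ Real.cos (k * dist c' c) := by
    by_contra hlt
    push Not at hlt
    nlinarith
  have hd := hA.dist_circumcenter_le hk hgeo subset_rfl hA.nonempty hr' hr
  have h5 := cos_one_le_imp_eq_zero (by positivity) (by nlinarith) h4
  exact dist_eq_zero.1 ((mul_eq_zero.1 h5).resolve_left hk.ne')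

end Chebyshev

/-! ### The curvature scale -/

section Scale

variable {M : Type*} [MetricSpace M]

theorem IsCurvatureBoundedAbove.curvatureScale_pos [CompactSpace M] {κ : ℝ}
    (hM : IsCurvatureBoundedAbove κ M) : 0 < curvatureScale κ M := by
  obtain ⟨k, hk, hκ⟩ : ∃ k : ℝ, 0 < k ∧ (0 < κ → k = √κ) := by
    by_cases h : 0 < κ
    · exact ⟨√κ, Real.sqrt_pos.2 h, fun _ => rfl⟩
    · exact ⟨1, one_pos, fun h' => absurd h' h⟩
  obtain ⟨r, hr, hkr, hloc⟩ := hM.exists_hasLocalMidpointInequality hk hκ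
  refine lt_min (hloc.convexityRadius_pos hk hr hkr hM.exists_geodesic) ?_
  have h := ofReal_pi_div_le_modelDiam hκ
  have h1 : 0 < ENNReal.ofReal (Real.pi / k) := ENNReal.ofReal_pos.2 (by positivity)
  exact ENNReal.div_pos (h1.trans_le h).ne' (by norm_num)

/-- For `κ ≤ 0` the model imposes no bound, and `k` is chosen from the diameter of `M`; the added
`1` avoids a zero denominator. -/
theorem exists_comparison_scale [CompactSpace M] (κ : ℝ) :
    ∃ k : ℝ, 0 < k ∧ (0 < κ → k = √κ) ∧
      ∀ x y : M, edist x y < curvatureScale κ M → k * dist x y ≤ Real.pi / 4 := by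
  by_cases h : 0 < κ
  · have hs : 0 < √κ := Real.sqrt_pos.2 h
    refine ⟨√κ, hs, fun _ => rfl, fun x y hxy => ?_⟩
    have h1 := hxy.trans_le (min_le_right _ _)
    unfold modelDiam at h1
    rw [if_pos h, edist_dist, show (4 : ℝ≥0∞) = ENNReal.ofReal 4 by simp,
      ← ENNReal.ofReal_div_of_pos (by norm_num), ENNReal.ofReal_lt_ofReal_iff (by positivity),
      div_div, lt_div_iff₀ (by positivity)] at h1
    linarith
  · refine ⟨Real.pi / (4 * (Metric.diam (Set.univ : Set M) + 1)),
      div_pos Real.pi_pos (by positivity), fun h' => absurd h' h, fun x y _ => ?_⟩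
    have h1 : dist x y ≤ Metric.diam (Set.univ : Set M) :=
      Metric.dist_le_diam_of_mem isCompact_univ.isBounded (Set.mem_univ x) (Set.mem_univ y)
    have h2 : 0 ≤ Metric.diam (Set.univ : Set M) := Metric.diam_nonneg
    rw [div_mul_eq_mul_div, div_le_div_iff₀ (by positivity) (by norm_num)]
    nlinarith [Real.pi_pos]

theorem IsCurvatureBoundedAbove.exists_isComparisonSet [CompactSpace M] {κ : ℝ}
    (hM : IsCurvatureBoundedAbove κ M) : ∃ k : ℝ, 0 < k ∧ ∀ A : Set M, A.Finite → A.Nonempty →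
      (∀ x ∈ A, ∀ y ∈ A, edist x y < curvatureScale κ M) →
      ∃ x ∈ A, ∃ y ∈ A, IsComparisonSet k (dist x y) A := by
  obtain ⟨k, hk, hκ, hscale⟩ := exists_comparison_scale (M := M) κ
  obtain ⟨r, hr, hkr, hloc⟩ := hM.exists_hasLocalMidpointInequality hk hκ
  refine ⟨k, hk, fun A hA hne hd => ?_⟩
  -- The diameter of a finite set is attained, so it is strictly below the scale; the strict bounds
  -- on `Θ` come from this.
  obtain ⟨⟨x, y⟩, ⟨hx, hy⟩, hmax⟩ := (hA.prod hA).exists_maximalFor (fun w : M × M => dist w.1 w.2)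
    _ (hne.prod hne)
  refine ⟨x, hx, y, hy, hA, hne, fun a ha b hb => ?_, hscale x y (hd x hx y hy),
    fun z hz p q hp hq γ hγ t => ?_⟩
  · by_contra hlt
    push Not at hlt
    exact hlt.not_ge (hmax (j := (a, b)) ⟨ha, hb⟩ hlt.le)
  · have hpi := Real.pi_pos
    have h1 := (hd x hx y hy).trans_le (min_le_left _ _)
    rw [edist_dist] at h1
    obtain ⟨s, hs0, h2, h3⟩ := ENNReal.lt_iff_exists_real_btwn.1 h1
    have h4 : dist x y < s := by
      by_contra hcon
      exact absurd h2 (not_lt.2 (ENNReal.ofReal_le_ofReal (not_lt.1 hcon)))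
    -- The radius exceeds the diameter of `A`, stays below the convexity radius, and keeps `k` times
    -- distances below `π / 2`.
    set s' := min s (Real.pi / (2 * k)) with hs'
    have h5 : dist x y < s' := by
      refine lt_min h4 ((lt_div_iff₀ (by positivity)).2 ?_)
      linarith [hscale x y (hd x hx y hy)]
    refine hloc.sin_interpolation_le_of_convex hk hr hkr hM.exists_geodesic (s := s')
      (dist_nonneg.trans_lt h5)
      (isGeodesicallyConvex_ball_of_lt_convexityRadius
        (lt_of_le_of_lt (ENNReal.ofReal_le_ofReal (min_le_left _ _)) h3) z)
      (hp.trans_lt h5) (hq.trans_lt h5) (fun w hw => ?_) hγ t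
    have := (lt_div_iff₀ (by positivity)).1 (hw.trans_le (min_le_right _ _))
    linarith

theorem IsCurvatureBoundedAbove.existsUnique_isChebyshevCenter [CompactSpace M] {κ : ℝ}
    (hM : IsCurvatureBoundedAbove κ M) {A : Set M} (hA : A.Finite) (hne : A.Nonempty)
    (hd : ∀ x ∈ A, ∀ y ∈ A, edist x y < curvatureScale κ M) : ∃! c, IsChebyshevCenter A c := by
  obtain ⟨k, hk, h⟩ := hM.exists_isComparisonSet
  obtain ⟨x, -, y, -, hcs⟩ := h A hA hne hd
  exact hcs.existsUnique_isChebyshevCenter hk hM.exists_geodesic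

theorem edist_lt_three_quarters {p q x y : M} {δ : ℝ≥0∞} (h : dist p q ≤ 3 / 4 * dist x y)
    (hxy : edist x y < δ) : edist p q < ((3 / 4 : ℝ≥0) : ℝ≥0∞) * δ := by
  have h0 : ((3 / 4 : ℝ≥0) : ℝ≥0∞) ≠ 0 := by simp
  refine lt_of_le_of_lt ?_ ((ENNReal.mul_lt_mul_iff_right h0 ENNReal.coe_ne_top).2 hxy)
  rw [edist_nndist, edist_nndist, ← ENNReal.coe_mul, ENNReal.coe_le_coe, ← NNReal.coe_le_coe]
  simpa using h

theorem IsCurvatureBoundedAbove.edist_center_lt [CompactSpace M] {κ : ℝ}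
    (hM : IsCurvatureBoundedAbove κ M) {A B : Set M} (hB : B.Finite) (hAB : A ⊆ B)
    (hA : A.Nonempty) {δ : ℝ≥0∞} (hδ : δ ≤ curvatureScale κ M)
    (hd : ∀ x ∈ B, ∀ y ∈ B, edist x y < δ) {c c' : M} (hc : IsChebyshevCenter A c)
    (hc' : IsChebyshevCenter B c') : edist c c' < ((3 / 4 : ℝ≥0) : ℝ≥0∞) * δ ∧
      ∀ b ∈ B, edist b c' < ((3 / 4 : ℝ≥0) : ℝ≥0∞) * δ := by
  obtain ⟨k, hk, h⟩ := hM.exists_isComparisonSet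
  obtain ⟨x, hx, y, hy, hcs⟩ := h B hB (hA.mono hAB)
    fun x hx y hy => (hd x hx y hy).trans_le hδ
  obtain ⟨r, hr⟩ := hc.exists_isCircumcenter
  obtain ⟨r', hr'⟩ := hc'.exists_isCircumcenter
  have hle := hcs.radius_le hk hM.exists_geodesic hr'
  exact ⟨edist_lt_three_quarters
    ((hcs.dist_circumcenter_le hk hM.exists_geodesic hAB hA hr hr').trans hle) (hd x hx y hy),
    fun b hb => edist_lt_three_quarters ((hr'.dist_le b hb).trans hle) (hd x hx y hy)⟩

end Scale

/-! ### The pseudo-barycenter map -/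

section Rips

variable {M : Type u} [MetricSpace M]

/-- The set of points spanned by a vertex of the subdivision of a Vietoris-Rips simplicial set. -/
def sdRipsPoints {δ : ℝ≥0∞} (v : (SSet.sd.obj (ripsSSet M δ)) _⦋0⦌) : Set M :=
  ripsPoint '' sdVertexSet _ v

theorem sdRipsPoints_sdVertex {δ : ℝ≥0∞} {n : ℕ} (x : (ripsSSet M δ) _⦋n⦌) :
    sdRipsPoints (sdVertex _ x) = Set.range x.1 := by
  unfold sdRipsPoints
  rw [sdVertexSet_sdVertex, ← Set.range_comp]
  rfl

theorem sdRipsPoints_map {δ ρ : ℝ≥0∞} (h : δ ≤ ρ) (v : (SSet.sd.obj (ripsSSet M δ)) _⦋0⦌) :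
    sdRipsPoints ((SSet.sd.map (ripsInclusion M h)).app _ v) = sdRipsPoints v := by
  unfold sdRipsPoints
  rw [sdVertexSet_map, Set.image_image]
  rfl

theorem sdRipsPoints_finite {δ : ℝ≥0∞} (v : (SSet.sd.obj (ripsSSet M δ)) _⦋0⦌) :
    (sdRipsPoints v).Finite := by
  obtain ⟨n, x, -, rfl⟩ := exists_sdVertex_nonDegenerate _ v
  rw [sdRipsPoints_sdVertex]
  exact Set.finite_range _

theorem sdRipsPoints_nonempty {δ : ℝ≥0∞} (v : (SSet.sd.obj (ripsSSet M δ)) _⦋0⦌) :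
    (sdRipsPoints v).Nonempty := by
  obtain ⟨n, x, -, rfl⟩ := exists_sdVertex_nonDegenerate _ v
  rw [sdRipsPoints_sdVertex]
  exact Set.range_nonempty _

theorem edist_lt_of_mem_sdRipsPoints {δ : ℝ≥0∞} (v : (SSet.sd.obj (ripsSSet M δ)) _⦋0⦌) :
    ∀ a ∈ sdRipsPoints v, ∀ b ∈ sdRipsPoints v, edist a b < δ := by
  obtain ⟨n, x, -, rfl⟩ := exists_sdVertex_nonDegenerate _ v
  rw [sdRipsPoints_sdVertex]
  rintro _ ⟨i, rfl⟩ _ ⟨j, rfl⟩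
  exact x.2 i j

theorem ripsPoint_lastVertexMap_mem {δ : ℝ≥0∞} (v : (SSet.sd.obj (ripsSSet M δ)) _⦋0⦌) :
    ripsPoint ((lastVertexMap.app (ripsSSet M δ)).app _ v) ∈ sdRipsPoints v := by
  obtain ⟨n, x, -, rfl⟩ := exists_sdVertex_nonDegenerate _ v
  rw [sdRipsPoints_sdVertex]
  exact ⟨Fin.last n, congrArg ripsPoint (lastVertexMap_sdVertex _ x).symm⟩

/-- The condition depends on a simplex only through its set of points, which is a function of the
vertex. Hence it is consistent and determines `Θ` everywhere. -/
theorem isChebyshevCenterMap_iff {ρ : ℝ≥0∞} (Θ : (SSet.sd.obj (ripsSSet M ρ)) _⦋0⦌ → M) :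
    IsChebyshevCenterMap M ρ Θ ↔ ∀ v, IsChebyshevCenter (sdRipsPoints v) (Θ v) := by
  constructor
  · intro h v
    obtain ⟨n, x, hx, rfl⟩ := exists_sdVertex_nonDegenerate _ v
    rw [sdRipsPoints_sdVertex]
    exact h n x hx
  · intro h n x _
    rw [← sdRipsPoints_sdVertex]
    exact h _

end Rips

theorem proposition5p4 (M : Type u) [MetricSpace M] [CompactSpace M] (κ : ℝ)
    (hM : IsCurvatureBoundedAbove κ M) :
    (∀ (n : ℕ) (x : (ripsSSet M (curvatureScale κ M)) _⦋n⦌),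
      ∃! c : M, IsChebyshevCenter (Set.range x.1) c) ∧
    (∃! Θ : (SSet.sd.obj (ripsSSet M (curvatureScale κ M))) _⦋0⦌ → M,
      IsChebyshevCenterMap M (curvatureScale κ M) Θ) ∧
    ∀ Θ : (SSet.sd.obj (ripsSSet M (curvatureScale κ M))) _⦋0⦌ → M,
      IsChebyshevCenterMap M (curvatureScale κ M) Θ →
      IsPseudoBarycenterMap M SSet.sd lastVertexMap (3 / 4) (3 / 4) (curvatureScale κ M) Θ := by
  refine ⟨fun n x => ?_, ?_, fun Θ hΘ => ?_⟩
  · refine hM.existsUnique_isChebyshevCenter (Set.finite_range _) (Set.range_nonempty _) ?_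
    rintro _ ⟨i, rfl⟩ _ ⟨j, rfl⟩
    exact x.2 i j
  · have hex : ∀ v : (SSet.sd.obj (ripsSSet M (curvatureScale κ M))) _⦋0⦌,
        ∃! c, IsChebyshevCenter (sdRipsPoints v) c := fun v =>
      hM.existsUnique_isChebyshevCenter (sdRipsPoints_finite v) (sdRipsPoints_nonempty v)
        (edist_lt_of_mem_sdRipsPoints v)
    choose Θ hΘ huniq using hex
    refine ⟨Θ, (isChebyshevCenterMap_iff Θ).2 hΘ, fun Θ' hΘ' => funext fun v => ?_⟩
    exact huniq v _ ((isChebyshevCenterMap_iff Θ').1 hΘ' v)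
  · rw [isChebyshevCenterMap_iff] at hΘ
    -- Passing to a larger scale does not change the set of points, so one map `Θ` gives centers at
    -- every scale `δ`.
    have hcenter : ∀ (δ : ℝ≥0∞) (h : δ ≤ curvatureScale κ M)
        (v : (SSet.sd.obj (ripsSSet M δ)) _⦋0⦌),
        IsChebyshevCenter (sdRipsPoints v) (Θ ((SSet.sd.map (ripsInclusion M h)).app _ v)) := by
      intro δ h v
      rw [← sdRipsPoints_map h v]
      exact hΘ _
    refine ⟨by norm_num, ?_, hM.curvatureScale_pos, fun δ h _ x => ?_, ?_⟩
    · rw [← NNReal.coe_lt_coe]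
      norm_num
    -- The last vertex is one of the points, so its distance to the center is at most the
    -- circumradius.
    · exact ((hM.edist_center_lt (sdRipsPoints_finite x) subset_rfl (sdRipsPoints_nonempty x) h
        (edist_lt_of_mem_sdRipsPoints x) (hcenter δ h x) (hcenter δ h x)).2 _
        (ripsPoint_lastVertexMap_mem x)).le
    · rintro δ h _ _ _ ⟨e, rfl, rfl⟩
      have hsub : sdRipsPoints ((SSet.sd.obj (ripsSSet M δ)).δ 1 e) ⊆
          sdRipsPoints ((SSet.sd.obj (ripsSSet M δ)).δ 0 e) :=
        Set.image_mono (sdVertexSet_mono _ e)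
      have := hM.edist_center_lt (sdRipsPoints_finite _) hsub (sdRipsPoints_nonempty _) h
        (edist_lt_of_mem_sdRipsPoints _) (hcenter δ h _) (hcenter δ h _)
      exact ⟨this.1, this.2 _ (hsub (ripsPoint_lastVertexMap_mem _))⟩
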